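/- Throughout, vector spaces are finite dimensional over $\mathbb{C}$. A *classical structure* $(\sigma,\tau)$ on $W$ is of one of the following kinds, where $\varepsilon\in\{1,-1\}$: (i) an anti-linear map $\sigma:W\to W$ with $\sigma^2=\varepsilon\,\mathrm{id}$ and no form (kind $\mathrm{Gl}(W,\sigma_\varepsilon)$); (ii) a nondegenerate hermitian form $\tau_*$ and no $\sigma$ (kind $\mathrm{Gl}(W,\tau_*)$); (iii) an anti-linear map $\sigma$ with $\sigma^2=\varepsilon\,\mathrm{id}$ and a nondegenerate symmetric, respectively alternating, complex bilinear form $\tau$ with $\tau(\sigma u,\sigma v)=\overline{\tau(u,v)}$ (kinds $\mathrm{O}(W,\sigma_\varepsilon,\tau)$ and $\mathrm{Sp}(W,\sigma_\varepsilon,\tau)$). Below, $\tau$ also stands for $\tau_*$, conditions on a map or form that is not part of the kind are omitted, and the kind is fixed. The real classical group $G(W,\sigma,\tau)$ consists of the complex linear bijections of $W$ which commute with $\sigma$ and preserve $\tau$; its Lie algebra $g(W,\sigma,\tau)$ consists of the $Y\in\mathrm{gl}(W)$ with $Y\sigma=\sigma Y$ and $\tau(Yu,v)+\tau(u,Yv)=0$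 for all $u,v\in W$. A *pair* $(Y,W;\sigma,\tau)$ is a space $W$ with a classical structure and an element $Y\in g(W,\sigma,\tau)$. A vector $v\in W$ is *special* if $v\neq 0$, $\tau(v,v)=0$ and, when the structure involves $\sigma$ with $\sigma^2=\mathrm{id}$, $\sigma v=\pm v$. A *triple* $(Y,W,v^0;\sigma,\tau)$ is a pair together with a special vector $v^0\in W$ such that $Yv^0=0$. Two pairs (triples) are equivalent if there is a complex linear bijection $P:W\to W'$ with $Y'=PYP^{-1}$, $\sigma'=P\sigma P^{-1}$, $P^*\tau'=\tau$ (and $Pv^0=(v')^0$). A *type* is an equivalence class of pairs and a *distinguished type* is an equivalence class of triples. Types are added by orthogonal direct sum, with the class of the zero space as $0$; the sum of a distinguished type and a type is the orthogonal direct sum with $v^0$ in the first summand. A type $\Delta\ne 0$ is *indecomposable* if it is not the sum of two nonzero types. A distinguished type is *indecomposable* if it is not the sum of a distinguished type and a nonzero type, and *nilpotent* if $Y$ is nilpotent. **Theorem 2.1.** Every distinguished type $\underline{\Delta}$ can be written as $\underline{\Delta}=\underline{\Delta}'+\Delta_1+\cdots+\Delta_k$ with $k\ge 0$, where $\underline{\Delta}'$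 is an indecomposable nilpotent distinguished type and $\Delta_1,\dots,\Delta_k$ are indecomposable types. The distinguished type $\underline{\Delta}'$ is unique and the types $\Delta_1,\dots,\Delta_k$ are unique up to reordering. Moreover, let $V$ be a space with a classical structure and $v^0\in V$ a special vector. Let $G_{v^0}=\{g\in G(V,\sigma,\tau): gv^0=v^0\}$ act on $g_{v^0}=\{X\in g(V,\sigma,\tau): Xv^0=0\}$ by $X\mapsto gXg^{-1}$. Sending the orbit of $Y$ to the class of $(Y,V,v^0;\sigma,\tau)$ is a well-defined bijection from the $G_{v^0}$-orbits on $g_{v^0}$ onto the distinguished types that have a representative $(Y',W',w^0;\sigma',\tau')$ for which there is a complex linear bijection $P:W'\to V$ with $P\sigma'=\sigma P$, $P^*\tau=\tau'$ and $Pw^0=v^0$. -/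

import Mathlib

open scoped ComplexConjugate

universe u

attribute [local instance] LieRing.ofAssociativeRing

namespace AffineOrbits

/-- The families of real classical groups.  The sign `ε` is the sign in `σ ^ 2 = ε • id`.
* `gl ε` : `Gl(V, σ_ε)`, i.e. `Gl(n, ℝ)` and `U*(n)`;
* `unitary` : `Gl(V, τ_*)`, i.e. `U(n - p, p)`;
* `o ε`  : `O(V, σ_ε, τ)`, i.e. `O(n - p, p)` and `O*(n)`;
* `sp ε` : `Sp(V, σ_ε, τ)`, i.e. `Sp(n, ℝ)` and `Sp(n - p, p)`. -/
inductive Kind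
  | gl (ε : ℤˣ)
  | unitary
  | o (ε : ℤˣ)
  | sp (ε : ℤˣ)

/-- An anti-linear map `σ` with `σ ^ 2 = id` is part of the structure. -/
def Kind.SigmaPlus : Kind → Prop
  | gl ε => ε = 1
  | unitary => False
  | o ε => ε = 1
  | sp ε => ε = 1

/-- The laws which the structure maps of a space of a given kind satisfy: `σ` is anti-linear, `τ` is
bilinear and `τs` (for `τ_*`) is sesquilinear, anti-linear in the first variable.  A structure map
which is not involved in a kind is recorded as `0`; then every condition about it which occurs
below (commuting with it, preserving it, being isotropic for it) is vacuous. -/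
def Kind.Law {W : Type u} [AddCommGroup W] [Module ℂ W] (σ : W →ₗ⋆[ℂ] W)
    (τ : W →ₗ[ℂ] W →ₗ[ℂ] ℂ) (τs : W →ₗ⋆[ℂ] W →ₗ[ℂ] ℂ) : Kind → Prop
  | gl ε => (∀ w, σ (σ w) = ε • w) ∧ τ = 0 ∧ τs = 0
  | unitary => σ = 0 ∧ τ = 0 ∧ (∀ u v, τs v u = conj (τs u v)) ∧ (∀ u, (∀ v, τs u v = 0) → u = 0)
  | o ε => (∀ w, σ (σ w) = ε • w) ∧ (∀ u v, τ (σ u) (σ v) = conj (τ u v)) ∧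
      (∀ u v, τ v u = τ u v) ∧ (∀ u, (∀ v, τ u v = 0) → u = 0) ∧ τs = 0
  | sp ε => (∀ w, σ (σ w) = ε • w) ∧ (∀ u v, τ (σ u) (σ v) = conj (τ u v)) ∧
      (∀ u, τ u u = 0) ∧ (∀ u, (∀ v, τ u v = 0) → u = 0) ∧ τs = 0

/-- A finite dimensional complex vector space with the structure `(σ, τ)` defining a real classical
group of kind `κ`. -/
structure Space (κ : Kind) where
  carrier : Type u
  [addCommGroup : AddCommGroup carrier]
  [module : Module ℂ carrier]
  [finiteDimensional : FiniteDimensional ℂ carrier]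
  σ : carrier →ₗ⋆[ℂ] carrier
  τ : carrier →ₗ[ℂ] carrier →ₗ[ℂ] ℂ
  τs : carrier →ₗ⋆[ℂ] carrier →ₗ[ℂ] ℂ
  law : κ.Law σ τ τs

namespace Space

variable {κ : Kind}

instance : CoeSort (Space.{u} κ) (Type u) := ⟨Space.carrier⟩

attribute [instance] Space.addCommGroup Space.module Space.finiteDimensional

/-- A complex linear bijection is compatible with the structures. -/
def Preserves (S T : Space.{u} κ) (P : S ≃ₗ[ℂ] T) : Prop :=
  (∀ v, P (S.σ v) = T.σ (P v)) ∧ (∀ u v, T.τ (P u) (P v) = S.τ u v) ∧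
    ∀ u v, T.τs (P u) (P v) = S.τs u v

theorem Preserves.refl (S : Space.{u} κ) : Preserves S S (LinearEquiv.refl ℂ S) :=
  ⟨fun _ => rfl, fun _ _ => rfl, fun _ _ => rfl⟩

theorem Preserves.symm {S T : Space.{u} κ} {P : S ≃ₗ[ℂ] T} (h : Preserves S T P) :
    Preserves T S P.symm := by
  refine ⟨fun v => ?_, fun u v => ?_, fun u v => ?_⟩
  · apply P.injective
    simp [h.1]
  · simp [← h.2.1]
  · simp [← h.2.2]

theorem Preserves.trans {S T U : Space.{u} κ} {P : S ≃ₗ[ℂ] T} {Q : T ≃ₗ[ℂ] U}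
    (h : Preserves S T P) (k : Preserves T U Q) : Preserves S U (P.trans Q) := by
  refine ⟨fun v => ?_, fun u v => ?_, fun u v => ?_⟩
  · simp [h.1, k.1]
  · simp [h.2.1, k.2.1]
  · simp [h.2.2, k.2.2]

/-- The real classical group `G(V, σ, τ)`. -/
def group (S : Space.{u} κ) : Subgroup (S ≃ₗ[ℂ] S) where
  carrier := {P | Preserves S S P}
  one_mem' := Preserves.refl S
  mul_mem' := fun {_ _} h k => Preserves.trans k h
  inv_mem' := fun {_} h => Preserves.symm h

/-- The Lie algebra `g(V, σ, τ)`, a real Lie subalgebra of `gl(V)`. -/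
def lieAlgebra (S : Space.{u} κ) : LieSubalgebra ℝ (Module.End ℂ S) where
  carrier := {Y | (∀ v, Y (S.σ v) = S.σ (Y v)) ∧ (∀ u v, S.τ (Y u) v + S.τ u (Y v) = 0) ∧
    ∀ u v, S.τs (Y u) v + S.τs u (Y v) = 0}
  zero_mem' := by simp
  add_mem' := by
    rintro X Y ⟨h1, h2, h3⟩ ⟨k1, k2, k3⟩
    refine ⟨fun v => by simp [h1, k1], fun u v => ?_, fun u v => ?_⟩
    · simp only [LinearMap.add_apply, map_add]
      linear_combination h2 u v + k2 u v
    · simp only [LinearMap.add_apply, map_add]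
      linear_combination h3 u v + k3 u v
  smul_mem' := by
    rintro r Y ⟨h1, h2, h3⟩
    have e : ∀ v, (r • Y) v = (r : ℂ) • Y v := fun v => by
      rw [LinearMap.smul_apply, Complex.coe_smul]
    refine ⟨fun v => ?_, fun u v => ?_, fun u v => ?_⟩
    · simp [e, h1, -Complex.coe_smul, LinearMap.map_smulₛₗ]
    · simp only [e, map_smul, LinearMap.smul_apply, smul_eq_mul]
      linear_combination (r : ℂ) * h2 u v
    · simp only [e, LinearMap.map_smulₛₗ, LinearMap.smul_apply, smul_eq_mul, Complex.conj_ofReal,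
        RingHom.id_apply]
      linear_combination (r : ℂ) * h3 u v
  lie_mem' := by
    rintro X Y ⟨h1, h2, h3⟩ ⟨k1, k2, k3⟩
    refine ⟨fun v => by simp [Ring.lie_def, h1, k1], fun u v => ?_, fun u v => ?_⟩
    · simp only [Ring.lie_def, LinearMap.sub_apply, Module.End.mul_apply, map_sub]
      linear_combination h2 (Y u) v - k2 u (X v) - k2 (X u) v + h2 u (Y v)
    · simp only [Ring.lie_def, LinearMap.sub_apply, Module.End.mul_apply, map_sub]
      linear_combination h3 (Y u) v - k3 u (X v) - k3 (X u) v + h3 u (Y v)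

/-- Special vectors: nonzero, isotropic for the form (if there is one), and `σ v = v` or
`σ v = -v` if the structure involves `σ` with `σ ^ 2 = id`.  If `σ ^ 2 = -id` there is no further
condition: no nonzero `v` satisfies `σ v = λ v`, as this gives `-v = σ (σ v) = (conj λ * λ) v`,
while every nonzero isotropic `v` is an eigenvector, for the eigenvalue `i`, of the complex linear
map `σ ∘ c` for a suitable complex conjugation `c` compatible with `σ` and `τ`. -/
def IsSpecial (S : Space.{u} κ) (v : S) : Prop :=
  v ≠ 0 ∧ (κ.SigmaPlus → S.σ v = v ∨ S.σ v = -v) ∧ S.τ v v = 0 ∧ S.τs v v = 0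

/-- The orthogonal direct sum of two spaces. -/
def sum (S T : Space.{u} κ) : Space.{u} κ where
  carrier := S × T
  σ :=
    { toFun := fun w => (S.σ w.1, T.σ w.2)
      map_add' := fun a b => by simp
      map_smul' := fun c a => by simp [LinearMap.map_smulₛₗ] }
  τ := LinearMap.mk₂ ℂ (fun u v => S.τ u.1 v.1 + T.τ u.2 v.2)
    (fun a b c => by simp; ring) (fun r a b => by simp; ring)
    (fun a b c => by simp; ring) (fun r a b => by simp; ring)
  τs := LinearMap.mk₂'ₛₗ (starRingEnd ℂ) (RingHom.id ℂ) (fun u v => S.τs u.1 v.1 + T.τs u.2 v.2)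
    (fun a b c => by simp; ring) (fun r a b => by simp [LinearMap.map_smulₛₗ]; ring)
    (fun a b c => by simp; ring) (fun r a b => by simp; ring)
  law := by
    have hs := S.law
    have ht := T.law
    have nd : ∀ {A B : Type u} [AddCommGroup A] [AddCommGroup B]
        (f : A → A → ℂ) (g : B → B → ℂ), (∀ u, f u 0 = 0) → (∀ u, g u 0 = 0) →
        (∀ u, (∀ v, f u v = 0) → u = 0) → (∀ u, (∀ v, g u v = 0) → u = 0) →
        ∀ u : A × B, (∀ v : A × B, f u.1 v.1 + g u.2 v.2 = 0) → u = 0 := by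
      intro A B _ _ f g f0 g0 hf hg u hu
      refine Prod.ext (hf _ fun v => ?_) (hg _ fun v => ?_)
      · simpa [g0] using hu (v, 0)
      · simpa [f0] using hu (0, v)
    cases κ with
    | gl ε =>
      obtain ⟨a1, a2, a3⟩ := hs
      obtain ⟨b1, b2, b3⟩ := ht
      refine ⟨fun w => Prod.ext (a1 _) (b1 _), ?_, ?_⟩
      · ext <;> simp [a2, b2]
      · ext <;> simp [a3, b3]
    | unitary =>
      obtain ⟨a1, a2, a3, a4⟩ := hs
      obtain ⟨b1, b2, b3, b4⟩ := ht
      refine ⟨?_, ?_, fun u v => ?_, ?_⟩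
      · ext w <;> simp [a1, b1]
      · ext <;> simp [a2, b2]
      · simp [a3 u.1, b3 u.2]
      · exact nd _ _ (by simp) (by simp) a4 b4
    | o ε =>
      obtain ⟨a1, a2, a3, a4, a5⟩ := hs
      obtain ⟨b1, b2, b3, b4, b5⟩ := ht
      refine ⟨fun w => Prod.ext (a1 _) (b1 _), fun u v => ?_, fun u v => ?_, ?_, ?_⟩
      · simp [a2, b2]
      · simp [a3 u.1, b3 u.2]
      · exact nd _ _ (by simp) (by simp) a4 b4
      · ext <;> simp [a5, b5]
    | sp ε =>
      obtain ⟨a1, a2, a3, a4, a5⟩ := hs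
      obtain ⟨b1, b2, b3, b4, b5⟩ := ht
      refine ⟨fun w => Prod.ext (a1 _) (b1 _), fun u v => ?_, fun u => ?_, ?_, ?_⟩
      · simp [a2, b2]
      · simp [a3, b3]
      · exact nd _ _ (by simp) (by simp) a4 b4
      · ext <;> simp [a5, b5]

/-- The zero space. -/
def zero (κ : Kind) : Space.{u} κ where
  carrier := PUnit
  σ := 0
  τ := 0
  τs := 0
  law := by cases κ <;> simp [Kind.Law]

end Space

/-- A pair `(Y, W; σ, τ)` with `Y` in the Lie algebra `g(W, σ, τ)`. -/
structure Pair (κ : Kind) where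
  space : Space.{u} κ
  Y : Module.End ℂ space
  mem : Y ∈ space.lieAlgebra

/-- A triple `(Y, W, v⁰; σ, τ)`. -/
structure Triple (κ : Kind) extends Pair.{u} κ where
  v₀ : space
  special : space.IsSpecial v₀
  Y_v₀ : Y v₀ = 0

variable {κ : Kind}

/-- `P : W → W'` carries the pair `A` to the pair `B`. -/
def Pair.IsEquiv (A B : Pair.{u} κ) (P : A.space ≃ₗ[ℂ] B.space) : Prop :=
  Space.Preserves A.space B.space P ∧ ∀ w, P (A.Y w) = B.Y (P w)

theorem Pair.IsEquiv.refl (A : Pair.{u} κ) : Pair.IsEquiv A A (LinearEquiv.refl ℂ A.space) :=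
  ⟨.refl _, fun _ => rfl⟩

theorem Pair.IsEquiv.symm {A B : Pair.{u} κ} {P : A.space ≃ₗ[ℂ] B.space}
    (h : Pair.IsEquiv A B P) : Pair.IsEquiv B A P.symm :=
  ⟨h.1.symm, fun w => P.injective (by simp [h.2])⟩

theorem Pair.IsEquiv.trans {A B C : Pair.{u} κ} {P : A.space ≃ₗ[ℂ] B.space}
    {Q : B.space ≃ₗ[ℂ] C.space} (h : Pair.IsEquiv A B P) (k : Pair.IsEquiv B C Q) :
    Pair.IsEquiv A C (P.trans Q) :=
  ⟨h.1.trans k.1, fun w => by simp [h.2, k.2]⟩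

/-- Equivalence of pairs. -/
instance Pair.setoid (κ : Kind) : Setoid (Pair.{u} κ) where
  r A B := ∃ P : A.space ≃ₗ[ℂ] B.space, Pair.IsEquiv A B P
  iseqv :=
    { refl := fun A => ⟨_, .refl A⟩
      symm := fun ⟨_, h⟩ => ⟨_, h.symm⟩
      trans := fun ⟨_, h⟩ ⟨_, k⟩ => ⟨_, h.trans k⟩ }

/-- Equivalence of triples. -/
instance Triple.setoid (κ : Kind) : Setoid (Triple.{u} κ) where
  r A B := ∃ P : A.space ≃ₗ[ℂ] B.space, Pair.IsEquiv A.toPair B.toPair P ∧ P A.v₀ = B.v₀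
  iseqv :=
    { refl := fun A => ⟨_, .refl A.toPair, rfl⟩
      symm := fun ⟨P, h, e⟩ => ⟨_, h.symm, P.injective (by simp [e])⟩
      trans := fun ⟨_, h, e⟩ ⟨_, k, f⟩ => ⟨_, h.trans k, by simp [e, f]⟩ }

/-- A type is an equivalence class of pairs. -/
def OrbitType (κ : Kind) : Type (u + 1) := Quotient (Pair.setoid.{u} κ)

/-- A distinguished type is an equivalence class of triples. -/
def DistType (κ : Kind) : Type (u + 1) := Quotient (Triple.setoid.{u} κ)

/-- The orthogonal direct sum of two pairs. -/
def Pair.sum (A B : Pair.{u} κ) : Pair.{u} κ where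
  space := A.space.sum B.space
  Y := A.Y.prodMap B.Y
  mem := by
    obtain ⟨a1, a2, a3⟩ := A.mem
    obtain ⟨b1, b2, b3⟩ := B.mem
    refine ⟨fun v => Prod.ext (a1 _) (b1 _), fun u v => ?_, fun u v => ?_⟩
    · change (A.space.τ (A.Y u.1) v.1 + B.space.τ (B.Y u.2) v.2) +
        (A.space.τ u.1 (A.Y v.1) + B.space.τ u.2 (B.Y v.2)) = 0
      linear_combination a2 u.1 v.1 + b2 u.2 v.2
    · change (A.space.τs (A.Y u.1) v.1 + B.space.τs (B.Y u.2) v.2) +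
        (A.space.τs u.1 (A.Y v.1) + B.space.τs u.2 (B.Y v.2)) = 0
      linear_combination a3 u.1 v.1 + b3 u.2 v.2

/-- The zero pair. -/
def Pair.zero (κ : Kind) : Pair.{u} κ where
  space := Space.zero κ
  Y := 0
  mem := zero_mem _

/-- The orthogonal direct sum of a triple and a pair; the distinguished vector lies in the first
summand. -/
def Triple.sum (A : Triple.{u} κ) (B : Pair.{u} κ) : Triple.{u} κ where
  toPair := A.toPair.sum B
  v₀ := ((A.v₀, 0) : A.space × B.space)
  special := by
    obtain ⟨h1, h2, h3, h4⟩ := A.special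
    refine ⟨fun h => h1 (congrArg Prod.fst h), fun h => ?_, ?_, ?_⟩
    · refine (h2 h).imp (fun e => ?_) (fun e => ?_)
      · exact Prod.ext e (map_zero B.space.σ)
      · exact Prod.ext e ((map_zero B.space.σ).trans neg_zero.symm)
    · change A.space.τ A.v₀ A.v₀ + B.space.τ 0 0 = 0
      simp [h3]
    · change A.space.τs A.v₀ A.v₀ + B.space.τs 0 0 = 0
      simp [h4]
  Y_v₀ := Prod.ext A.Y_v₀ (map_zero B.Y)

theorem Pair.IsEquiv.sum {A A' B B' : Pair.{u} κ} {P : A.space ≃ₗ[ℂ] A'.space}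
    {Q : B.space ≃ₗ[ℂ] B'.space} (h : Pair.IsEquiv A A' P) (k : Pair.IsEquiv B B' Q) :
    Pair.IsEquiv (A.sum B) (A'.sum B') (P.prodCongr Q) := by
  refine ⟨⟨fun v => Prod.ext (h.1.1 _) (k.1.1 _), fun u v => ?_, fun u v => ?_⟩,
    fun w => Prod.ext (h.2 _) (k.2 _)⟩
  · exact congrArg₂ (· + ·) (h.1.2.1 u.1 v.1) (k.1.2.1 u.2 v.2)
  · exact congrArg₂ (· + ·) (h.1.2.2 u.1 v.1) (k.1.2.2 u.2 v.2)

/-- The sum of types, represented by orthogonal direct sums; the zero type is that of the zero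
space. -/
instance OrbitType.instAddCommMonoid (κ : Kind) : AddCommMonoid (OrbitType.{u} κ) where
  add := Quotient.map₂ Pair.sum fun _ _ ⟨_, h⟩ _ _ ⟨_, k⟩ => ⟨_, h.sum k⟩
  zero := Quotient.mk _ (Pair.zero κ)
  nsmul := @nsmulRec _ ⟨Quotient.mk _ (Pair.zero κ)⟩
    ⟨Quotient.map₂ Pair.sum fun _ _ ⟨_, h⟩ _ _ ⟨_, k⟩ => ⟨_, h.sum k⟩⟩
  add_assoc := by
    rintro ⟨A⟩ ⟨B⟩ ⟨C⟩
    refine Quotient.sound ⟨LinearEquiv.prodAssoc ℂ A.space B.space C.space,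
      ⟨fun _ => rfl, fun u v => ?_, fun u v => ?_⟩, fun _ => rfl⟩
    · exact (add_assoc _ _ _).symm
    · exact (add_assoc _ _ _).symm
  zero_add := by
    rintro ⟨A⟩
    refine Quotient.sound ⟨LinearEquiv.uniqueProd (R := ℂ) (M := A.space) (M₂ := PUnit.{u + 1}),
      ⟨fun _ => rfl, fun u v => ?_, fun u v => ?_⟩, fun _ => rfl⟩
    · exact (zero_add _).symm
    · exact (zero_add _).symm
  add_zero := by
    rintro ⟨A⟩
    refine Quotient.sound ⟨LinearEquiv.prodUnique (R := ℂ) (M := A.space) (M₂ := PUnit.{u + 1}),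
      ⟨fun _ => rfl, fun u v => ?_, fun u v => ?_⟩, fun _ => rfl⟩
    · exact (add_zero _).symm
    · exact (add_zero _).symm
  add_comm := by
    rintro ⟨A⟩ ⟨B⟩
    refine Quotient.sound ⟨LinearEquiv.prodComm ℂ A.space B.space,
      ⟨fun _ => rfl, fun u v => ?_, fun u v => ?_⟩, fun _ => rfl⟩
    · exact add_comm _ _
    · exact add_comm _ _

/-- The sum of a distinguished type and a type. -/
instance DistType.instHAdd (κ : Kind) :
    HAdd (DistType.{u} κ) (OrbitType.{u} κ) (DistType.{u} κ) where
  hAdd := Quotient.map₂ Triple.sum fun _ _ ⟨_, h, e⟩ _ _ ⟨Q, k⟩ =>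
    ⟨_, h.sum k, Prod.ext e (map_zero Q)⟩

/-- A type is indecomposable if it is nonzero and not the sum of two nonzero types. -/
def OrbitType.IsIndecomposable (Δ : OrbitType.{u} κ) : Prop :=
  Δ ≠ 0 ∧ ∀ Δ₁ Δ₂ : OrbitType.{u} κ, Δ = Δ₁ + Δ₂ → Δ₁ = 0 ∨ Δ₂ = 0

/-- A distinguished type is indecomposable if it is not the sum of a distinguished type and a
nonzero type. -/
def DistType.IsIndecomposable (D : DistType.{u} κ) : Prop :=
  ∀ (D₁ : DistType.{u} κ) (Δ₂ : OrbitType.{u} κ), D = D₁ + Δ₂ → Δ₂ = 0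

/-- A distinguished type, represented by `(Y, W, v⁰; σ, τ)`, is nilpotent if `Y` is nilpotent. -/
def DistType.IsNilpotent (D : DistType.{u} κ) : Prop :=
  ∃ A : Triple.{u} κ, D = Quotient.mk _ A ∧ _root_.IsNilpotent A.Y

namespace Space

/-- The isotropy group `G(V, σ, τ)_{v⁰}`. -/
def isotropyGroup (S : Space.{u} κ) (v₀ : S) : Subgroup (S ≃ₗ[ℂ] S) where
  carrier := {P | P ∈ S.group ∧ P v₀ = v₀}
  one_mem' := ⟨S.group.one_mem, rfl⟩
  mul_mem' := fun {P _} h k => ⟨S.group.mul_mem h.1 k.1, (congrArg P k.2).trans h.2⟩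
  inv_mem' := fun {P} h => ⟨S.group.inv_mem h.1, (LinearEquiv.symm_apply_eq P).2 h.2.symm⟩

/-- The Lie algebra `g(V, σ, τ)_{v⁰}` of the isotropy group. -/
def isotropyLieAlgebra (S : Space.{u} κ) (v₀ : S) : LieSubalgebra ℝ (Module.End ℂ S) where
  carrier := {Y | Y ∈ S.lieAlgebra ∧ Y v₀ = 0}
  zero_mem' := ⟨zero_mem _, rfl⟩
  add_mem' := fun {X Y} h k => ⟨add_mem h.1 k.1, by simp [h.2, k.2]⟩
  smul_mem' := fun r Y h => ⟨S.lieAlgebra.smul_mem r h.1, by simp [h.2]⟩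
  lie_mem' := fun {X Y} h k => ⟨S.lieAlgebra.lie_mem h.1 k.1, by simp [Ring.lie_def, h.2, k.2]⟩

/-- The adjoint action `(P, X) ↦ P X P⁻¹`. -/
instance adjointAction (S : Space.{u} κ) (v₀ : S) :
    MulAction (S.isotropyGroup v₀) (S.isotropyLieAlgebra v₀) where
  smul P X := ⟨P.1.conj X.1, by
    obtain ⟨⟨p1, p2, p3⟩, p4⟩ := P.2
    obtain ⟨⟨x1, x2, x3⟩, x4⟩ := X.2
    have q1 := (Preserves.symm (show Preserves S S P.1 from ⟨p1, p2, p3⟩)).1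
    refine ⟨⟨fun v => ?_, fun u v => ?_, fun u v => ?_⟩, ?_⟩
    · simp [LinearEquiv.conj_apply, q1, x1, p1]
    · have := x2 (P.1.symm u) (P.1.symm v)
      rw [← p2, ← p2 (P.1.symm u)] at this
      simpa [LinearEquiv.conj_apply] using this
    · have := x3 (P.1.symm u) (P.1.symm v)
      rw [← p3, ← p3 (P.1.symm u)] at this
      simpa [LinearEquiv.conj_apply] using this
    · have : P.1.symm v₀ = v₀ := (LinearEquiv.symm_apply_eq _).2 p4.symm
      simp [LinearEquiv.conj_apply, this, x4]⟩
  one_smul _ := rfl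
  mul_smul _ _ _ := rfl

/-- The triple `(Y, V, v⁰; σ, τ)` given by an element `Y` of `g(V, σ, τ)_{v⁰}`. -/
def triple (S : Space.{u} κ) {v₀ : S} (hv : S.IsSpecial v₀) (Y : S.isotropyLieAlgebra v₀) :
    Triple.{u} κ where
  space := S
  Y := Y.1
  mem := Y.2.1
  v₀ := v₀
  special := hv
  Y_v₀ := Y.2.2

/-- The distinguished types which have a representative on the space `(V, v⁰; σ, τ)` up to
isomorphism. -/
def distTypes (S : Space.{u} κ) (v₀ : S) : Set (DistType.{u} κ) :=
  {D | ∃ A : Triple.{u} κ, D = Quotient.mk _ A ∧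
    ∃ P : A.space ≃ₗ[ℂ] S, Preserves A.space S P ∧ P A.v₀ = v₀}

end Space

end AffineOrbits

/-!
The argument avoids the classification of the indecomposable types and treats all kinds at once.

Two maps `f : A → B`, `g : B → A` which commute with `σ` and `Y` and are adjoint for the forms are
recorded by `Pair.IsAdjoint`; for the kinds without a form this puts no relation between `f` and
`g`. Write `f*` for `g`. The orthogonal summands of a pair are the images of its self-adjoint
idempotents. If `a` is self-adjoint then so is every real polynomial in `a`, and some of these are
the idempotents which belong to the primary decomposition of `a`. Hence a self-adjoint
endomorphism of an indecomposable pair has a single eigenvalue up to complex conjugation. If that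
eigenvalue is not in `(-∞, 0]`, then `a = s ^ 2` where `s` is a real polynomial in `a`, by
Newton's method modulo powers of a real irreducible polynomial. For any self-adjoint `a`, this
applies to `a` or to `1 - a` (`Pair.IsAdjoint.exists_sqrt`).

* An indecomposable `A` is prime: if `A` is a summand of `U + V`, with embedding `f`, then `1 = f*
  π_U f + f* π_V f`, so that one of the two terms is `s ^ 2`, say the first. Then `π_U f s⁻¹` is
  an isometric embedding of `A` into `U` (`OrbitType.IsIndecomposable.exists_eq_add`).
* An indecomposable `A` can be cancelled: let `f`, `f'` be two embeddings of `A` into `W`. If `c =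
  1 - f'* f` is invertible, then the reflection `1 - (f - f') c⁻¹ (f - f')*` carries `f` to `f'`.
  If `f* f' f'* f = s ^ 2`, this can be achieved by composing `f'` with an isometry of `A`,
  obtained from the polar decomposition of `f'* f`. Otherwise `A` embeds into the complement of
  the image of `f'`, and comparison with this third copy gives the result
  (`OrbitType.IsIndecomposable.add_left_cancel`).

Together these give the unique decomposition of types. In an indecomposable triple, the primary
component of a self-adjoint `a` which contains an eigenvector `v⁰` of `a` is everything. Applied
to `Y ^ 2`, this shows that `Y` is nilpotent. If the same triple is decomposed in two ways, with
indecomposable distinguished summands embedded by `f₁` and `f₂`, put `e = f₂* f₁`. Both `e* e` and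
`e e*` fix `v⁰`, so they are unipotent, and `e (e* e)^(-1/2)` is an equivalence between the two
summands which respects `v⁰` (`Triple.distType_eq_of_isIndecomposable`). The remaining summands
are then unique by cancellation of types.
-/

namespace AffineOrbits

section Polynomial

open Polynomial

/-! ### Real polynomials in an algebraic element -/

/-- The component of `a` at an irreducible polynomial `q` is cut out by an idempotent polynomial
in `a`. -/
theorem exists_idempotent_aeval {E : Type*} [Ring E] [Algebra ℝ E] {a : E} (ha : IsIntegral ℝ a)
    {q : ℝ[X]} (hq : Irreducible q) :
    ∃ (p : ℝ[X]) (n : ℕ), aeval a p * aeval a p = aeval a p ∧ q ∣ p - 1 ∧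
      aeval a q ^ n * aeval a p = 0 := by
  obtain ⟨r, hr, hqr⟩ := (FiniteMultiplicity.of_prime_left hq.prime
    (minpoly.ne_zero ha)).exists_eq_pow_mul_and_not_dvd
  set n := multiplicity q (minpoly ℝ a)
  have hz : aeval a q ^ n * aeval a r = 0 := by
    rw [← map_pow, ← map_mul, ← hr, minpoly.aeval]
  obtain ⟨u, v, huv⟩ : IsCoprime (q ^ (n + 1)) r :=
    ((hq.coprime_iff_not_dvd).2 hqr).pow_left
  refine ⟨v * r, n, ?_, ⟨-(u * q ^ n), by linear_combination huv⟩, ?_⟩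
  · rw [← sub_eq_zero, ← map_mul, ← map_sub]
    have : v * r * (v * r) - v * r = -(u * q * v) * (q ^ n * r) := by
      linear_combination (v * r) * huv
    rw [this, map_mul, map_mul _ (q ^ n), map_pow, hz, mul_zero]
  · rw [mul_comm v r, map_mul, ← mul_assoc, hz, zero_mul]

theorem exists_pow_dvd_sq_sub {q p₀ g : ℝ[X]} (hq : Irreducible q) (hg : ¬ q ∣ g)
    (h : q ∣ p₀ ^ 2 - g) (k : ℕ) : ∃ p : ℝ[X], q ^ (k + 1) ∣ p ^ 2 - g := by
  induction k with
  | zero => exact ⟨p₀, by simpa using h⟩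
  | succ k ih =>
    obtain ⟨p, b, hb⟩ := ih
    have hp : ¬ q ∣ 2 * p := by
      intro hd
      apply hg
      have h2 : q ∣ p := by
        obtain ⟨c, hc⟩ := hd
        refine ⟨C (1 / 2) * c, ?_⟩
        have h3 : (C (1 / 2) : ℝ[X]) * 2 = 1 := by
          rw [← C_ofNat, ← C_mul]; norm_num
        linear_combination C (1 / 2) * hc - p * h3
      have : g = p * p - q ^ (k + 1) * b := by linear_combination -hb
      rw [this]
      exact dvd_sub (h2.mul_right _) ((dvd_pow_self q k.succ_ne_zero).mul_right _)
    obtain ⟨u, v, huv⟩ := (hq.coprime_iff_not_dvd).2 hp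
    -- Newton's step: correct `p` by the multiple of `q ^ (k + 1)` which kills `b` modulo `q`
    refine ⟨p - q ^ (k + 1) * (v * b), u * b + q ^ k * (v * b) ^ 2, ?_⟩
    linear_combination hb + q ^ (k + 1) * b * (-huv)

theorem exists_aeval_eq_of_im_ne_zero {z : ℂ} (hz : z.im ≠ 0) (w : ℂ) :
    ∃ p : ℝ[X], aeval z p = w := by
  refine ⟨C (w.im / z.im) * X + C (w.re - w.im / z.im * z.re), ?_⟩
  apply Complex.ext <;> simp
  field_simp

/-- Modulo each power of the minimal polynomial of `z`, a real polynomial `g` whose value at `z` is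
not in `(-∞, 0]` has a square root. -/
theorem exists_minpoly_pow_dvd_sq_sub (z : ℂ) {g : ℝ[X]} (hg : aeval z g ∈ Complex.slitPlane)
    (k : ℕ) : ∃ p : ℝ[X], minpoly ℝ z ^ k ∣ p ^ 2 - g := by
  have hint : IsIntegral ℝ z := Algebra.IsIntegral.isIntegral z
  have hq := minpoly.irreducible hint
  suffices h : ∃ p₀ : ℝ[X], aeval z p₀ ^ 2 = aeval z g by
    obtain ⟨p₀, hp₀⟩ := h
    obtain ⟨p, hp⟩ := exists_pow_dvd_sq_sub (g := g) hq
      (fun hd => Complex.slitPlane_ne_zero hg ((minpoly.dvd_iff).1 hd))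
      (minpoly.dvd ℝ z (p := p₀ ^ 2 - g) (by simp [hp₀])) k
    exact ⟨p, (pow_dvd_pow _ k.le_succ).trans hp⟩
  by_cases hz : z.im = 0
  · have hz' : z = algebraMap ℝ ℂ z.re := Complex.ext (by simp) (by simp [hz])
    have hgz : aeval z g = algebraMap ℝ ℂ (g.eval z.re) := by
      conv_lhs => rw [hz', aeval_algebraMap_apply]
      simp
    have hpos : 0 < g.eval z.re := by
      rw [hgz] at hg
      simpa using hg
    refine ⟨C (√(g.eval z.re)), ?_⟩
    rw [hgz, aeval_C, ← map_pow, Real.sq_sqrt hpos.le]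
  · obtain ⟨w, hw⟩ := IsAlgClosed.exists_pow_nat_eq (aeval z g) (n := 2) (by norm_num)
    obtain ⟨p, hp⟩ := exists_aeval_eq_of_im_ne_zero hz w
    exact ⟨p, by rw [hp, hw]⟩

/-- If the only idempotents in the real subalgebra generated by `a` are `0` and `1`, then `a` has a
single eigenvalue `z` up to complex conjugation. -/
theorem exists_isNilpotent_aeval_minpoly {E : Type*} [Ring E] [Nontrivial E] [Algebra ℝ E] {a : E}
    (ha : IsIntegral ℝ a)
    (h : ∀ p : ℝ[X], aeval a p * aeval a p = aeval a p → aeval a p = 0 ∨ aeval a p = 1) :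
    ∃ z : ℂ, IsNilpotent (aeval a (minpoly ℝ z)) := by
  obtain ⟨z, hz⟩ := IsAlgClosed.exists_aeval_eq_zero ℂ (minpoly ℝ a) (minpoly.degree_pos ha).ne'
  have hq := minpoly.irreducible (Algebra.IsIntegral.isIntegral (R := ℝ) z)
  obtain ⟨p, n, hp, hd, h0⟩ := exists_idempotent_aeval ha hq
  refine ⟨z, n, ?_⟩
  rcases h p hp with h' | h'
  · exfalso
    have h1 := (minpoly.dvd ℝ z hz).trans (minpoly.dvd ℝ a h')
    exact hq.not_isUnit (isUnit_of_dvd_one (by simpa using dvd_sub h1 hd))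
  · simpa [h'] using h0

/-- If `z` is the only eigenvalue of `a` up to conjugation and `g z` is not in `(-∞, 0]`, then `g a`
has a square root which is a real polynomial in `a`. -/
theorem exists_aeval_mul_self_eq {E : Type*} [Ring E] [Algebra ℝ E] {a : E} {z : ℂ}
    (hz : IsNilpotent (aeval a (minpoly ℝ z))) {g : ℝ[X]} (hg : aeval z g ∈ Complex.slitPlane) :
    ∃ p : ℝ[X], aeval a p * aeval a p = aeval a g := by
  obtain ⟨k, hk⟩ := hz
  obtain ⟨p, c, hc⟩ := exists_minpoly_pow_dvd_sq_sub z hg k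
  refine ⟨p, ?_⟩
  rw [← sub_eq_zero, ← map_mul, ← map_sub, ← sq, hc, map_mul, map_pow, hk, zero_mul]

theorem isUnit_aeval_of_isNilpotent_minpoly {E : Type*} [Ring E] [Algebra ℝ E] {a : E} {z : ℂ}
    (hz : IsNilpotent (aeval a (minpoly ℝ z))) {g : ℝ[X]} (hg : aeval z g ≠ 0) :
    IsUnit (aeval a g) := by
  obtain ⟨k, hk⟩ := hz
  have hq := minpoly.irreducible (Algebra.IsIntegral.isIntegral (R := ℝ) z)
  obtain ⟨u, v, huv⟩ : IsCoprime (minpoly ℝ z ^ k) g :=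
    ((hq.coprime_iff_not_dvd).2 fun hd => hg ((minpoly.dvd_iff).1 hd)).pow_left
  have h := congrArg (aeval a) huv
  rw [map_add, map_mul, map_mul, map_pow, hk, mul_zero, zero_add, map_one] at h
  refine isUnit_iff_exists.2 ⟨aeval a v, ?_, h⟩
  rw [← h, ← map_mul, ← map_mul, mul_comm]

theorem aeval_apply_of_eigenvector {E : Type*} [AddCommGroup E] [Module ℂ E]
    {a : Module.End ℂ E} {v : E} {c : ℝ} (hv : a v = c • v) (p : Polynomial ℝ) :
    Polynomial.aeval a p v = p.eval c • v := by
  induction p using Polynomial.induction_on' with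
  | add p q hp hq => simp [hp, hq, add_smul]
  | monomial n r =>
    have hpow : (a ^ n) v = c ^ n • v := by
      induction n with
      | zero => simp
      | succ n ih =>
        rw [pow_succ', Module.End.mul_apply, ih, LinearMap.map_smul_of_tower, hv, smul_smul,
          ← pow_succ]
    rw [Polynomial.aeval_monomial, ← Algebra.smul_def, LinearMap.smul_apply, hpow, smul_smul,
      Polynomial.eval_monomial]

end Polynomial

variable {κ : Kind}

/-! ### Adjoint maps between pairs -/

/-- Complex linear maps `f : A → B` and `g : B → A` which commute with the structure maps `σ` and
with the operators `Y`, and are adjoint to each other for the forms.  For the kinds without a form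
the last condition is void, so that `f` and `g` are then unrelated. -/
structure Pair.IsAdjoint (A B : Pair.{u} κ) (f : A.space →ₗ[ℂ] B.space)
    (g : B.space →ₗ[ℂ] A.space) : Prop where
  map_σ : ∀ x, f (A.space.σ x) = B.space.σ (f x)
  map_σ' : ∀ y, g (B.space.σ y) = A.space.σ (g y)
  map_Y : ∀ x, f (A.Y x) = B.Y (f x)
  map_Y' : ∀ y, g (B.Y y) = A.Y (g y)
  τ_left : ∀ x y, B.space.τ (f x) y = A.space.τ x (g y)
  τ_right : ∀ x y, B.space.τ y (f x) = A.space.τ (g y) x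
  τs_left : ∀ x y, B.space.τs (f x) y = A.space.τs x (g y)
  τs_right : ∀ x y, B.space.τs y (f x) = A.space.τs (g y) x

namespace Pair.IsAdjoint

variable {A B C : Pair.{u} κ} {f f' : A.space →ₗ[ℂ] B.space} {g g' : B.space →ₗ[ℂ] A.space}

theorem id (A : Pair.{u} κ) : IsAdjoint A A 1 1 := by
  constructor <;> intros <;> rfl

theorem zero (A B : Pair.{u} κ) : IsAdjoint A B 0 0 := by
  constructor <;> simp

theorem symm (h : IsAdjoint A B f g) : IsAdjoint B A g f where
  map_σ := h.map_σ'
  map_σ' := h.map_σ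
  map_Y := h.map_Y'
  map_Y' := h.map_Y
  τ_left x y := (h.τ_right y x).symm
  τ_right x y := (h.τ_left y x).symm
  τs_left x y := (h.τs_right y x).symm
  τs_right x y := (h.τs_left y x).symm

theorem comp {h : B.space →ₗ[ℂ] C.space} {k : C.space →ₗ[ℂ] B.space} (H : IsAdjoint B C h k)
    (F : IsAdjoint A B f g) : IsAdjoint A C (h ∘ₗ f) (g ∘ₗ k) := by
  constructor
  · simp [F.map_σ, H.map_σ]
  · simp [F.map_σ', H.map_σ']
  · simp [F.map_Y, H.map_Y]
  · simp [F.map_Y', H.map_Y']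
  · simp [F.τ_left, H.τ_left]
  · simp [F.τ_right, H.τ_right]
  · simp [F.τs_left, H.τs_left]
  · simp [F.τs_right, H.τs_right]

theorem add (F : IsAdjoint A B f g) (F' : IsAdjoint A B f' g') :
    IsAdjoint A B (f + f') (g + g') := by
  constructor
  · simp [F.map_σ, F'.map_σ]
  · simp [F.map_σ', F'.map_σ']
  · simp [F.map_Y, F'.map_Y]
  · simp [F.map_Y', F'.map_Y']
  · simp [F.τ_left, F'.τ_left]
  · simp [F.τ_right, F'.τ_right]
  · simp [F.τs_left, F'.τs_left]
  · simp [F.τs_right, F'.τs_right]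

theorem smul (r : ℝ) (F : IsAdjoint A B f g) : IsAdjoint A B (r • f) (r • g) := by
  have e : ∀ {U V : Pair.{u} κ} (l : U.space →ₗ[ℂ] V.space) v, (r • l) v = (r : ℂ) • l v :=
    fun l v => by rw [LinearMap.smul_apply, Complex.coe_smul]
  constructor
  · simp [e, F.map_σ, -Complex.coe_smul, LinearMap.map_smulₛₗ]
  · simp [e, F.map_σ', -Complex.coe_smul, LinearMap.map_smulₛₗ]
  · simp [e, F.map_Y, -Complex.coe_smul]
  · simp [e, F.map_Y', -Complex.coe_smul]
  · simp [e, F.τ_left, -Complex.coe_smul]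
  · simp [e, F.τ_right, -Complex.coe_smul]
  · simp [e, F.τs_left, -Complex.coe_smul, LinearMap.map_smulₛₗ]
  · simp [e, F.τs_right, -Complex.coe_smul, LinearMap.map_smulₛₗ]

theorem neg (F : IsAdjoint A B f g) : IsAdjoint A B (-f) (-g) := by
  simpa using F.smul (-1)

theorem sub (F : IsAdjoint A B f g) (F' : IsAdjoint A B f' g') :
    IsAdjoint A B (f - f') (g - g') := by
  simpa [sub_eq_add_neg] using F.add F'.neg

theorem mul {f f' g g' : Module.End ℂ A.space} (F : IsAdjoint A A f g) (F' : IsAdjoint A A f' g') :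
    IsAdjoint A A (f * f') (g' * g) :=
  F.comp F'

/-- Inverses of adjoint maps are adjoint. -/
theorem inverse {f' : B.space →ₗ[ℂ] A.space} {g' : A.space →ₗ[ℂ] B.space} (F : IsAdjoint A B f g)
    (h₁ : ∀ x, f' (f x) = x) (h₂ : ∀ y, f (f' y) = y) (k₁ : ∀ y, g' (g y) = y)
    (k₂ : ∀ x, g (g' x) = x) : IsAdjoint B A f' g' := by
  constructor
  · intro y
    rw [← h₂ y, ← F.map_σ, h₁, h₂]
  · intro x
    rw [← k₂ x, ← F.map_σ', k₁, k₂]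
  · intro y
    rw [← h₂ y, ← F.map_Y, h₁, h₂]
  · intro x
    rw [← k₂ x, ← F.map_Y', k₁, k₂]
  · intro y x
    rw [← k₂ x, ← F.τ_left, h₂, k₂]
  · intro y x
    rw [← k₂ x, ← F.τ_right, h₂, k₂]
  · intro y x
    rw [← k₂ x, ← F.τs_left, h₂, k₂]
  · intro y x
    rw [← k₂ x, ← F.τs_right, h₂, k₂]

/-- Real polynomials in a self-adjoint endomorphism are self-adjoint. -/
theorem aeval {a : Module.End ℂ A.space} (h : IsAdjoint A A a a) (p : Polynomial ℝ) :
    IsAdjoint A A (Polynomial.aeval a p) (Polynomial.aeval a p) := by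
  have hpow : ∀ n : ℕ, IsAdjoint A A (a ^ n) (a ^ n) := by
    intro n
    induction n with
    | zero => simpa using IsAdjoint.id A
    | succ n ih =>
      have := ih.mul h
      rwa [← pow_succ, ← pow_succ'] at this
  induction p using Polynomial.induction_on' with
  | add p q hp hq => simpa using hp.add hq
  | monomial n r =>
    have := (hpow n).smul r
    rwa [Polynomial.aeval_monomial, ← Algebra.smul_def]

/-- The operator `Y` of a pair is skew-adjoint. -/
theorem Y_neg_Y (A : Pair.{u} κ) : IsAdjoint A A A.Y (-A.Y) := by
  obtain ⟨h₁, h₂, h₃⟩ := A.mem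
  constructor
  · exact h₁
  · simp [h₁]
  · simp
  · simp
  · intro x y
    simpa using eq_neg_of_add_eq_zero_left (h₂ x y)
  · intro x y
    simpa using eq_neg_of_add_eq_zero_right (h₂ y x)
  · intro x y
    simpa using eq_neg_of_add_eq_zero_left (h₃ x y)
  · intro x y
    simpa using eq_neg_of_add_eq_zero_right (h₃ y x)

theorem isEquiv {P : A.space ≃ₗ[ℂ] B.space}
    (h : IsAdjoint A B P.toLinearMap P.symm.toLinearMap) : Pair.IsEquiv A B P :=
  ⟨⟨h.map_σ, fun u v => by simpa using h.τ_left u (P v),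
    fun u v => by simpa using h.τs_left u (P v)⟩, h.map_Y⟩

end Pair.IsAdjoint

theorem Pair.IsEquiv.isAdjoint {A B : Pair.{u} κ} {P : A.space ≃ₗ[ℂ] B.space}
    (h : Pair.IsEquiv A B P) : IsAdjoint A B P.toLinearMap P.symm.toLinearMap where
  map_σ := h.1.1
  map_σ' := h.symm.1.1
  map_Y := h.2
  map_Y' := h.symm.2
  τ_left x y := by simp [← h.1.2.1]
  τ_right x y := by simp [← h.1.2.1]
  τs_left x y := by simp [← h.1.2.2]
  τs_right x y := by simp [← h.1.2.2]

/-- The type of a pair. -/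
def Pair.orbitType (A : Pair.{u} κ) : OrbitType.{u} κ := Quotient.mk _ A

/-- The distinguished type of a triple. -/
def Triple.distType (A : Triple.{u} κ) : DistType.{u} κ := Quotient.mk _ A

/-! ### Orthogonal decompositions -/

/-- `W` is the orthogonal sum of the images of `f : A → W` and `h : B → W`; the maps `g` and `k` are
the adjoint projections. -/
structure Pair.IsDecomp (A B W : Pair.{u} κ) (f : A.space →ₗ[ℂ] W.space)
    (g : W.space →ₗ[ℂ] A.space) (h : B.space →ₗ[ℂ] W.space) (k : W.space →ₗ[ℂ] B.space) :
    Prop where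
  adj₁ : IsAdjoint A W f g
  adj₂ : IsAdjoint B W h k
  g_f : ∀ x, g (f x) = x
  k_h : ∀ y, k (h y) = y
  add_eq : ∀ w, f (g w) + h (k w) = w

namespace Pair

/-- The inclusion of the first summand. -/
def inl (A B : Pair.{u} κ) : A.space →ₗ[ℂ] (A.sum B).space := LinearMap.inl ℂ A.space B.space

/-- The inclusion of the second summand. -/
def inr (A B : Pair.{u} κ) : B.space →ₗ[ℂ] (A.sum B).space := LinearMap.inr ℂ A.space B.space

/-- The projection to the first summand. -/
def fst (A B : Pair.{u} κ) : (A.sum B).space →ₗ[ℂ] A.space := LinearMap.fst ℂ A.space B.space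

/-- The projection to the second summand. -/
def snd (A B : Pair.{u} κ) : (A.sum B).space →ₗ[ℂ] B.space := LinearMap.snd ℂ A.space B.space

end Pair

namespace Pair.IsDecomp

variable {A B B' W W' : Pair.{u} κ} {f : A.space →ₗ[ℂ] W.space}
  {g : W.space →ₗ[ℂ] A.space} {h : B.space →ₗ[ℂ] W.space} {k : W.space →ₗ[ℂ] B.space}

theorem swap (D : IsDecomp A B W f g h k) : IsDecomp B A W h k f g :=
  ⟨D.adj₂, D.adj₁, D.k_h, D.g_f, fun w => by rw [add_comm, D.add_eq]⟩

theorem g_h (D : IsDecomp A B W f g h k) (y : B.space) : g (h y) = 0 := by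
  have h₁ : f (g (h y)) = 0 := by simpa [D.k_h] using D.add_eq (h y)
  rw [← D.g_f (g (h y)), h₁, map_zero]

theorem k_f (D : IsDecomp A B W f g h k) (x : A.space) : k (f x) = 0 :=
  D.swap.g_h x

theorem inl_fst (A B : Pair.{u} κ) :
    IsDecomp A B (A.sum B) (inl A B) (fst A B) (inr A B) (snd A B) where
  adj₁ :=
    { map_σ := fun x => Prod.ext rfl (map_zero B.space.σ).symm
      map_σ' := fun _ => rfl
      map_Y := fun x => Prod.ext rfl (map_zero B.Y).symm
      map_Y' := fun _ => rfl
      τ_left := fun x y => by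
        change A.space.τ x y.1 + B.space.τ 0 y.2 = A.space.τ x y.1
        simp
      τ_right := fun x y => by
        change A.space.τ y.1 x + B.space.τ y.2 0 = A.space.τ y.1 x
        simp
      τs_left := fun x y => by
        change A.space.τs x y.1 + B.space.τs 0 y.2 = A.space.τs x y.1
        simp
      τs_right := fun x y => by
        change A.space.τs y.1 x + B.space.τs y.2 0 = A.space.τs y.1 x
        simp }
  adj₂ :=
    { map_σ := fun x => Prod.ext (map_zero A.space.σ).symm rfl
      map_σ' := fun _ => rfl
      map_Y := fun x => Prod.ext (map_zero A.Y).symm rfl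
      map_Y' := fun _ => rfl
      τ_left := fun x y => by
        change A.space.τ 0 y.1 + B.space.τ x y.2 = B.space.τ x y.2
        simp
      τ_right := fun x y => by
        change A.space.τ y.1 0 + B.space.τ y.2 x = B.space.τ y.2 x
        simp
      τs_left := fun x y => by
        change A.space.τs 0 y.1 + B.space.τs x y.2 = B.space.τs x y.2
        simp
      τs_right := fun x y => by
        change A.space.τs y.1 0 + B.space.τs y.2 x = B.space.τs y.2 x
        simp }
  g_f _ := rfl
  k_h _ := rfl
  add_eq w := Prod.ext (add_zero _) (zero_add _)

/-- Transport of a decomposition along an equivalence. -/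
theorem map (D : IsDecomp A B W f g h k) {P : W.space ≃ₗ[ℂ] W'.space}
    (hP : Pair.IsEquiv W W' P) :
    IsDecomp A B W' (P.toLinearMap ∘ₗ f) (g ∘ₗ P.symm.toLinearMap) (P.toLinearMap ∘ₗ h)
      (k ∘ₗ P.symm.toLinearMap) where
  adj₁ := hP.isAdjoint.comp D.adj₁
  adj₂ := hP.isAdjoint.comp D.adj₂
  g_f x := by simp [D.g_f]
  k_h y := by simp [D.k_h]
  add_eq w := by simp [← map_add, D.add_eq]

/-- The equivalence with the orthogonal direct sum which is given by a decomposition. -/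
def equiv (D : IsDecomp A B W f g h k) : W.space ≃ₗ[ℂ] (A.sum B).space :=
  LinearEquiv.ofLinearMap (g.prod k) (f.coprod h)
    (LinearMap.ext fun x : A.space × B.space => Prod.ext
      (by
        change g (f x.1 + h x.2) = x.1
        rw [map_add, D.g_f, D.g_h, add_zero])
      (by
        change k (f x.1 + h x.2) = x.2
        rw [map_add, D.k_h, D.k_f, zero_add]))
    (LinearMap.ext fun w => D.add_eq w)

theorem isEquiv (D : IsDecomp A B W f g h k) : Pair.IsEquiv W (A.sum B) D.equiv := by
  refine ⟨⟨fun v => Prod.ext (D.adj₁.map_σ' v) (D.adj₂.map_σ' v), fun u v => ?_, fun u v => ?_⟩,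
    fun w => Prod.ext (D.adj₁.map_Y' w) (D.adj₂.map_Y' w)⟩
  · change A.space.τ (g u) (g v) + B.space.τ (k u) (k v) = _
    rw [← D.adj₁.τ_right, ← D.adj₂.τ_right, ← map_add, D.add_eq]
  · change A.space.τs (g u) (g v) + B.space.τs (k u) (k v) = _
    rw [← D.adj₁.τs_right, ← D.adj₂.τs_right, ← map_add, D.add_eq]

theorem mk_eq (D : IsDecomp A B W f g h k) :
  W.orbitType = A.orbitType + B.orbitType :=
  Quotient.sound ⟨_, D.isEquiv⟩

/-- Two orthogonal complements of the same summand are equivalent. -/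
theorem complement_unique {h' : B'.space →ₗ[ℂ] W.space} {k' : W.space →ₗ[ℂ] B'.space}
    (D : IsDecomp A B W f g h k) (D' : IsDecomp A B' W f g h' k') :
    B.orbitType = B'.orbitType := by
  have e : ∀ w, h' (k' w) = h (k w) := fun w =>
    add_left_cancel ((D'.add_eq w).trans (D.add_eq w).symm)
  have e₁ : (k' ∘ₗ h) ∘ₗ (k ∘ₗ h') = LinearMap.id := LinearMap.ext fun y => by
    simp [← e, D'.k_h]
  have e₂ : (k ∘ₗ h') ∘ₗ (k' ∘ₗ h) = LinearMap.id := LinearMap.ext fun y => by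
    simp [e, D.k_h]
  exact Quotient.sound ⟨LinearEquiv.ofLinearMap (k' ∘ₗ h) (k ∘ₗ h') e₁ e₂,
    IsAdjoint.isEquiv (D'.adj₂.symm.comp D.adj₂)⟩

end Pair.IsDecomp

namespace Pair

/-- The summand of a pair cut out by a self-adjoint idempotent `e`: the range of `e` with the
restricted structure. -/
def part (A : Pair.{u} κ) (e : Module.End ℂ A.space) (he : IsAdjoint A A e e)
    (hi : ∀ x, e (e x) = e x) : Pair.{u} κ :=
  have hfix : ∀ x : LinearMap.range e, e x = x := by
    rintro ⟨_, x, rfl⟩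
    exact hi x
  { space :=
      { carrier := LinearMap.range e
        σ :=
          { toFun := fun x => ⟨A.space.σ x, A.space.σ x, by rw [he.map_σ, hfix]⟩
            map_add' := fun x y => Subtype.ext (by simp)
            map_smul' := fun c x => Subtype.ext (by simp [LinearMap.map_smulₛₗ]) }
        τ := A.space.τ.domRestrict₁₂ (LinearMap.range e) (LinearMap.range e)
        τs := A.space.τs.domRestrict₁₂ (LinearMap.range e) (LinearMap.range e)
        law := by
          have nd : ∀ F : A.space → A.space → ℂ, (∀ x y, F (e x) y = F x (e y)) →
              (∀ u, (∀ v, F u v = 0) → u = 0) →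
              ∀ u : LinearMap.range e, (∀ v : LinearMap.range e, F u v = 0) → u = 0 := by
            intro F hF hF0 u hu
            refine Subtype.ext (hF0 _ fun v => ?_)
            rw [← hfix u, hF]
            exact hu ⟨e v, v, rfl⟩
          have hA := A.space.law
          cases κ with
          | gl ε =>
            obtain ⟨a1, a2, a3⟩ := hA
            exact ⟨fun w => Subtype.ext (a1 _),
              LinearMap.ext₂ fun x y => congrArg (fun t => t x.1 y.1) a2,
              LinearMap.ext₂ fun x y => congrArg (fun t => t x.1 y.1) a3⟩
          | unitary =>
            obtain ⟨a1, a2, a3, a4⟩ := hA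
            exact ⟨by ext; simp [a1],
              LinearMap.ext₂ fun x y => congrArg (fun t => t x.1 y.1) a2, fun u v => a3 _ _,
              nd (fun x y => A.space.τs x y) he.τs_left a4⟩
          | o ε =>
            obtain ⟨a1, a2, a3, a4, a5⟩ := hA
            exact ⟨fun w => Subtype.ext (a1 _), fun u v => a2 _ _, fun u v => a3 _ _,
              nd (fun x y => A.space.τ x y) he.τ_left a4,
              LinearMap.ext₂ fun x y => congrArg (fun t => t x.1 y.1) a5⟩
          | sp ε =>
            obtain ⟨a1, a2, a3, a4, a5⟩ := hA
            exact ⟨fun w => Subtype.ext (a1 _), fun u v => a2 _ _, fun u => a3 _,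
              nd (fun x y => A.space.τ x y) he.τ_left a4,
              LinearMap.ext₂ fun x y => congrArg (fun t => t x.1 y.1) a5⟩ }
    Y := A.Y.restrict (p := LinearMap.range e) (q := LinearMap.range e)
      fun x hx => ⟨A.Y x, by rw [he.map_Y, hfix ⟨x, hx⟩]⟩
    mem := ⟨fun v => Subtype.ext (A.mem.1 _), fun u v => A.mem.2.1 _ _, fun u v => A.mem.2.2 _ _⟩ }

variable {A B W : Pair.{u} κ}

theorem part_isAdjoint {e : Module.End ℂ A.space} (he : IsAdjoint A A e e)
    (hi : ∀ x, e (e x) = e x) :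
    IsAdjoint (A.part e he hi) A (LinearMap.range e).subtype e.rangeRestrict := by
  have hfix : ∀ x : LinearMap.range e, e x = x := by
    rintro ⟨_, x, rfl⟩
    exact hi x
  constructor
  · intro x; rfl
  · intro x; exact Subtype.ext (he.map_σ x)
  · intro x; rfl
  · intro x; exact Subtype.ext (he.map_Y x)
  · intro (x : LinearMap.range e) y
    change A.space.τ x.1 y = A.space.τ x.1 (e y)
    rw [← he.τ_left, hfix]
  · intro (x : LinearMap.range e) y
    change A.space.τ y x.1 = A.space.τ (e y) x.1
    rw [he.τ_left, hfix]
  · intro (x : LinearMap.range e) y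
    change A.space.τs x.1 y = A.space.τs x.1 (e y)
    rw [← he.τs_left, hfix]
  · intro (x : LinearMap.range e) y
    change A.space.τs y x.1 = A.space.τs (e y) x.1
    rw [he.τs_left, hfix]

/-- An isometric embedding has an orthogonal complement. -/
theorem IsAdjoint.exists_isDecomp {f : A.space →ₗ[ℂ] W.space} {g : W.space →ₗ[ℂ] A.space}
    (H : IsAdjoint A W f g) (hgf : ∀ x, g (f x) = x) :
    ∃ (B : Pair.{u} κ) (h : B.space →ₗ[ℂ] W.space) (k : W.space →ₗ[ℂ] B.space),
      IsDecomp A B W f g h k := by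
  have he : IsAdjoint W W (1 - f ∘ₗ g) (1 - f ∘ₗ g) := (IsAdjoint.id W).sub (H.comp H.symm)
  have hi : ∀ x, (1 - f ∘ₗ g) ((1 - f ∘ₗ g) x) = (1 - f ∘ₗ g) x := fun x => by simp [hgf]
  refine ⟨W.part _ he hi, _, _, H, part_isAdjoint he hi, hgf, ?_, fun w => ?_⟩
  · rintro ⟨_, x, rfl⟩
    exact Subtype.ext (hi x)
  · change f (g w) + (w - f (g w)) = w
    simp

/-- A self-adjoint idempotent gives an orthogonal decomposition into its range and its kernel. -/
theorem IsAdjoint.isDecomp_part {e : Module.End ℂ W.space} (he : IsAdjoint W W e e)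
    (hi : ∀ x, e (e x) = e x) :
    ∃ (B : Pair.{u} κ) (h : B.space →ₗ[ℂ] W.space) (k : W.space →ₗ[ℂ] B.space),
      IsDecomp (W.part e he hi) B W (LinearMap.range e).subtype e.rangeRestrict h k := by
  refine (part_isAdjoint he hi).exists_isDecomp ?_
  rintro ⟨_, x, rfl⟩
  exact Subtype.ext (hi x)

end Pair

/-! ### The dimension of a type -/

theorem OrbitType.exists_pair (Δ : OrbitType.{u} κ) : ∃ A : Pair.{u} κ, A.orbitType = Δ :=
  Quotient.exists_rep Δ

namespace Pair

variable {A B U V W : Pair.{u} κ}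

theorem orbitType_sum (A B : Pair.{u} κ) : (A.sum B).orbitType = A.orbitType + B.orbitType :=
  rfl

theorem orbitType_eq_zero_iff : A.orbitType = 0 ↔ ∀ x : A.space, x = 0 := by
  constructor
  · intro h x
    obtain ⟨P, -⟩ : ∃ P, Pair.IsEquiv A (Pair.zero κ) P := Quotient.exact h
    exact P.injective (Subsingleton.elim (α := PUnit) _ _)
  · intro h
    have h' : ∀ x : (Pair.zero.{u} κ).space, x = 0 := fun x => Subsingleton.elim (α := PUnit) _ _
    refine Quotient.sound ⟨LinearEquiv.ofLinearMap 0 0 (LinearMap.ext fun x => ?_)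
      (LinearMap.ext fun x => ?_), IsAdjoint.isEquiv (IsAdjoint.zero _ _)⟩
    · exact (h' _).trans (h' _).symm
    · exact (h _).trans (h _).symm

theorem exists_isDecomp_of_orbitType_eq (h : W.orbitType = A.orbitType + B.orbitType) :
    ∃ f g h k, IsDecomp A B W f g h k := by
  obtain ⟨P, hP⟩ : ∃ P, Pair.IsEquiv W (A.sum B) P := Quotient.exact h
  exact ⟨_, _, _, _, (IsDecomp.inl_fst A B).map hP.symm⟩

end Pair

/-- The complex dimension of the underlying space. -/
noncomputable def OrbitType.dim : OrbitType.{u} κ → ℕ :=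
  Quotient.lift (fun A => Module.finrank ℂ A.space) fun _ _ ⟨P, _⟩ => P.finrank_eq

theorem OrbitType.dim_add (Δ₁ Δ₂ : OrbitType.{u} κ) : (Δ₁ + Δ₂).dim = Δ₁.dim + Δ₂.dim := by
  obtain ⟨A, rfl⟩ := Δ₁.exists_pair
  obtain ⟨B, rfl⟩ := Δ₂.exists_pair
  exact Module.finrank_prod (R := ℂ) (M := A.space) (M' := B.space)

theorem OrbitType.dim_pos {Δ : OrbitType.{u} κ} (h : Δ ≠ 0) : 0 < Δ.dim := by
  obtain ⟨A, rfl⟩ := Δ.exists_pair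
  refine Nat.pos_of_ne_zero fun h0 => h (Pair.orbitType_eq_zero_iff.2 fun x => ?_)
  have : Subsingleton A.space := Module.finrank_zero_iff.1 h0
  exact Subsingleton.elim _ _

/-! ### Self-adjoint endomorphisms of indecomposable pairs -/

namespace Pair

variable {A B U V W : Pair.{u} κ}

theorem isIntegral_end (a : Module.End ℂ A.space) : IsIntegral ℝ a := by
  have : Module.Finite ℝ (Module.End ℂ A.space) := Module.Finite.trans ℂ _
  exact Algebra.IsIntegral.isIntegral a

theorem IsAdjoint.eq_zero_or_eq_one (hA : A.orbitType.IsIndecomposable)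
    {e : Module.End ℂ A.space} (he : IsAdjoint A A e e) (hi : e * e = e) : e = 0 ∨ e = 1 := by
  obtain ⟨B, h, k, D⟩ := he.isDecomp_part (LinearMap.congr_fun hi)
  rcases hA.2 _ _ D.mk_eq with h0 | h0 <;> rw [orbitType_eq_zero_iff] at h0
  · left
    ext x
    exact congrArg Subtype.val (h0 (e.rangeRestrict x))
  · right
    ext x
    have := D.add_eq x
    rw [h0 (k x), map_zero, add_zero] at this
    exact this

/-- A self-adjoint endomorphism of an indecomposable pair has a single eigenvalue up to complex
conjugation. -/
theorem IsAdjoint.exists_isNilpotent_aeval_minpoly (hA : A.orbitType.IsIndecomposable)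
    {a : Module.End ℂ A.space} (ha : IsAdjoint A A a a) :
    ∃ z : ℂ, IsNilpotent (Polynomial.aeval a (minpoly ℝ z)) := by
  have : Nontrivial (Module.End ℂ A.space) := by
    refine ⟨1, 0, fun h => hA.1 (orbitType_eq_zero_iff.2 fun x => ?_)⟩
    simpa using LinearMap.congr_fun h x
  exact AffineOrbits.exists_isNilpotent_aeval_minpoly (isIntegral_end a)
    fun p hp => (ha.aeval p).eq_zero_or_eq_one hA hp

/-- As `a` has a single eigenvalue up to conjugation, `a` or `1 - a` has no eigenvalue in
`(-∞, 0]`. -/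
theorem IsAdjoint.exists_sqrt (hA : A.orbitType.IsIndecomposable)
    {a : Module.End ℂ A.space} (ha : IsAdjoint A A a a) :
    ∃ s t : Module.End ℂ A.space, IsAdjoint A A s s ∧ IsAdjoint A A t t ∧ s * t = 1 ∧ t * s = 1 ∧
      (s * s = a ∨ s * s = 1 - a) := by
  obtain ⟨z, hz⟩ := ha.exists_isNilpotent_aeval_minpoly hA
  have key : ∀ g : Polynomial ℝ, Polynomial.aeval z g ∈ Complex.slitPlane →
      ∃ s t : Module.End ℂ A.space, IsAdjoint A A s s ∧ IsAdjoint A A t t ∧ s * t = 1 ∧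
        t * s = 1 ∧ s * s = Polynomial.aeval a g := by
    intro g hg
    obtain ⟨p, hp⟩ := exists_aeval_mul_self_eq hz hg
    have hu := isUnit_aeval_of_isNilpotent_minpoly hz (Complex.slitPlane_ne_zero hg)
    rw [← hp] at hu
    obtain ⟨t, h₁, h₂⟩ := isUnit_iff_exists.1
      ((Commute.refl (Polynomial.aeval a p)).isUnit_mul_iff.1 hu).1
    have hs := ha.aeval p
    exact ⟨_, t, hs, hs.inverse (LinearMap.congr_fun h₂) (LinearMap.congr_fun h₁)
      (LinearMap.congr_fun h₂) (LinearMap.congr_fun h₁), h₁, h₂, hp⟩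
  have : z ∈ Complex.slitPlane ∨ 1 - z ∈ Complex.slitPlane := by
    simp only [Complex.mem_slitPlane_iff, Complex.sub_re, Complex.sub_im, Complex.one_re,
      Complex.one_im]
    by_cases h : 0 < z.re
    · exact .inl (.inl h)
    · exact .inr (.inl (by linarith))
  rcases this with h | h
  · obtain ⟨s, t, hs, ht, h₁, h₂, h₃⟩ := key Polynomial.X (by simpa using h)
    exact ⟨s, t, hs, ht, h₁, h₂, .inl (by simpa using h₃)⟩
  · obtain ⟨s, t, hs, ht, h₁, h₂, h₃⟩ := key (1 - Polynomial.X) (by simpa using h)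
    exact ⟨s, t, hs, ht, h₁, h₂, .inr (by simpa using h₃)⟩

theorem IsAdjoint.isUnit_one_sub_or_add (hA : A.orbitType.IsIndecomposable)
    {a : Module.End ℂ A.space} (ha : IsAdjoint A A a a) : IsUnit (1 - a) ∨ IsUnit (1 + a) := by
  obtain ⟨z, hz⟩ := ha.exists_isNilpotent_aeval_minpoly hA
  by_cases h : 1 - z = 0
  · right
    have : Polynomial.aeval z (1 + Polynomial.X : Polynomial ℝ) ≠ 0 := by
      rw [sub_eq_zero] at h
      rw [map_add, map_one, Polynomial.aeval_X, ← h]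
      norm_num
    simpa using isUnit_aeval_of_isNilpotent_minpoly hz this
  · left
    have := isUnit_aeval_of_isNilpotent_minpoly hz
      (g := (1 - Polynomial.X : Polynomial ℝ)) (by simpa using h)
    rwa [map_sub, map_one, Polynomial.aeval_X] at this

/-! ### An indecomposable type is prime -/

/-- If `s ^ 2` is the compression to `A` of the orthogonal projection onto `U`, then that projection
composed with `s⁻¹` embeds `A` isometrically into `U`. -/
theorem IsAdjoint.exists_isDecomp_of_sq {f : A.space →ₗ[ℂ] W.space} {g : W.space →ₗ[ℂ] A.space}
    {f' : U.space →ₗ[ℂ] W.space} {g' : W.space →ₗ[ℂ] U.space} (F : IsAdjoint A W f g)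
    (F' : IsAdjoint U W f' g') {s t : Module.End ℂ A.space} (ht : IsAdjoint A A t t)
    (hst : s * t = 1) (hts : t * s = 1) (h : ∀ x, s (s x) = g (f' (g' (f x)))) :
    ∃ (B : Pair.{u} κ) (h : B.space →ₗ[ℂ] U.space) (k : U.space →ₗ[ℂ] B.space),
      IsDecomp A B U (g' ∘ₗ f ∘ₗ t) (t ∘ₗ g ∘ₗ f') h k := by
  refine IsAdjoint.exists_isDecomp (f := g' ∘ₗ f ∘ₗ t) (g := t ∘ₗ g ∘ₗ f')
    (F'.symm.comp (F.comp ht)) fun x => ?_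
  have h₁ : s (t x) = x := LinearMap.congr_fun hst x
  have h₂ : t (s x) = x := LinearMap.congr_fun hts x
  simp [← h, h₁, h₂]

theorem IsDecomp.exists_sqrt (hA : A.orbitType.IsIndecomposable) {f : A.space →ₗ[ℂ] W.space}
    {g : W.space →ₗ[ℂ] A.space} (F : IsAdjoint A W f g) (hgf : ∀ x, g (f x) = x)
    {f' : U.space →ₗ[ℂ] W.space} {g' : W.space →ₗ[ℂ] U.space}
    {h' : V.space →ₗ[ℂ] W.space} {k' : W.space →ₗ[ℂ] V.space} (D : IsDecomp U V W f' g' h' k') :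
    ∃ s t : Module.End ℂ A.space, IsAdjoint A A s s ∧ IsAdjoint A A t t ∧ s * t = 1 ∧ t * s = 1 ∧
      ((∀ x, s (s x) = g (f' (g' (f x)))) ∨ ∀ x, s (s x) = g (h' (k' (f x)))) := by
  have ha : IsAdjoint A A (g ∘ₗ f' ∘ₗ g' ∘ₗ f) (g ∘ₗ f' ∘ₗ g' ∘ₗ f) :=
    F.symm.comp (D.adj₁.comp (D.adj₁.symm.comp F))
  obtain ⟨s, t, hs, ht, h₁, h₂, h₃⟩ := ha.exists_sqrt hA
  refine ⟨s, t, hs, ht, h₁, h₂, h₃.imp (fun h => LinearMap.congr_fun h) fun h x => ?_⟩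
  have h₄ : s (s x) = x - g (f' (g' (f x))) := LinearMap.congr_fun h x
  have h₅ := congrArg g (D.add_eq (f x))
  rw [map_add, hgf] at h₅
  rw [h₄]
  exact sub_eq_of_eq_add' h₅.symm

end Pair

theorem OrbitType.IsIndecomposable.exists_eq_add {Δ Γ Δ₁ Δ₂ : OrbitType.{u} κ}
    (hΔ : Δ.IsIndecomposable) (h : Δ₁ + Δ₂ = Δ + Γ) :
    (∃ Γ₁, Δ₁ = Δ + Γ₁) ∨ ∃ Γ₂, Δ₂ = Δ + Γ₂ := by
  obtain ⟨A, rfl⟩ := Δ.exists_pair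
  obtain ⟨C, rfl⟩ := Γ.exists_pair
  obtain ⟨U, rfl⟩ := Δ₁.exists_pair
  obtain ⟨V, rfl⟩ := Δ₂.exists_pair
  obtain ⟨f, g, _, _, D⟩ := Pair.exists_isDecomp_of_orbitType_eq (W := U.sum V) h
  have D' := Pair.IsDecomp.inl_fst U V
  obtain ⟨s, t, hs, ht, h₁, h₂, h₃⟩ := D'.exists_sqrt hΔ D.adj₁ D.g_f
  rcases h₃ with h₃ | h₃
  · obtain ⟨B, _, _, E⟩ := D.adj₁.exists_isDecomp_of_sq D'.adj₁ ht h₁ h₂ h₃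
    exact .inl ⟨_, E.mk_eq⟩
  · obtain ⟨B, _, _, E⟩ := D.adj₁.exists_isDecomp_of_sq D'.adj₂ ht h₁ h₂ h₃
    exact .inr ⟨_, E.mk_eq⟩

/-! ### Cancellation of types -/

namespace Pair.IsDecomp

variable {A U V W : Pair.{u} κ} {f f' : A.space →ₗ[ℂ] W.space}
  {g g' : W.space →ₗ[ℂ] A.space} {h : U.space →ₗ[ℂ] W.space} {k : W.space →ₗ[ℂ] U.space}
  {h' : V.space →ₗ[ℂ] W.space} {k' : W.space →ₗ[ℂ] V.space}

/-- If `c = 1 - f'* f` is invertible, then `1 - (f - f') c⁻¹ (f - f')*` is an automorphism of `W`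
which carries the embedding `f` to the embedding `f'`, and hence the orthogonal complement of the
former to that of the latter.  For the kinds without a form, the invertibility of `c* = 1 - f* f'`
does not follow from that of `c`. -/
theorem complement_eq_of_isUnit (D : IsDecomp A U W f g h k) (D' : IsDecomp A V W f' g' h' k')
    (hc : IsUnit (1 - g' ∘ₗ f)) (hc' : IsUnit (1 - g ∘ₗ f')) : U.orbitType = V.orbitType := by
  have H : IsAdjoint A A (1 - g' ∘ₗ f) (1 - g ∘ₗ f') :=
    (IsAdjoint.id A).sub (D'.adj₁.symm.comp D.adj₁)
  obtain ⟨i, hi₁, hi₂⟩ := isUnit_iff_exists.1 hc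
  obtain ⟨j, hj₁, hj₂⟩ := isUnit_iff_exists.1 hc'
  have Hi : IsAdjoint A A i j := H.inverse (LinearMap.congr_fun hi₂) (LinearMap.congr_fun hi₁)
    (LinearMap.congr_fun hj₂) (LinearMap.congr_fun hj₁)
  have ei : ∀ x, g' (f (i x)) = i x - x := fun x => by
    have : i x - g' (f (i x)) = x := LinearMap.congr_fun hi₁ x
    rw [eq_sub_iff_add_eq, ← eq_sub_iff_add_eq', this]
  have ei' : ∀ x, i (g' (f x)) = i x - x := fun x => by
    have : i (x - g' (f x)) = x := LinearMap.congr_fun hi₂ x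
    rw [map_sub] at this
    rw [eq_sub_iff_add_eq, ← eq_sub_iff_add_eq', this]
  have ej : ∀ x, g (f' (j x)) = j x - x := fun x => by
    have : j x - g (f' (j x)) = x := LinearMap.congr_fun hj₁ x
    rw [eq_sub_iff_add_eq, ← eq_sub_iff_add_eq', this]
  have ej' : ∀ x, j (g (f' x)) = j x - x := fun x => by
    have : j (x - g (f' x)) = x := LinearMap.congr_fun hj₂ x
    rw [map_sub] at this
    rw [eq_sub_iff_add_eq, ← eq_sub_iff_add_eq', this]
  let d := f - f'
  let δ := g - g'
  have hd : IsAdjoint A W d δ := D.adj₁.sub D'.adj₁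
  have hR : IsAdjoint W W (1 - d ∘ₗ i ∘ₗ δ) (1 - d ∘ₗ j ∘ₗ δ) :=
    (IsAdjoint.id W).sub (hd.comp (Hi.comp hd.symm))
  have h₁ : (1 - d ∘ₗ i ∘ₗ δ) ∘ₗ (1 - d ∘ₗ j ∘ₗ δ) = LinearMap.id := by
    ext w
    simp [d, δ, D.g_f, D'.g_f, ei', ej]
    abel
  have h₂ : (1 - d ∘ₗ j ∘ₗ δ) ∘ₗ (1 - d ∘ₗ i ∘ₗ δ) = LinearMap.id := by
    ext w
    simp [d, δ, D.g_f, D'.g_f, ei, ej']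
    abel
  have hP := IsAdjoint.isEquiv (P := LinearEquiv.ofLinearMap _ _ h₁ h₂) hR
  have E := D.map hP
  have hf : (1 - d ∘ₗ i ∘ₗ δ) ∘ₗ f = f' := by
    ext x
    simp [d, δ, D.g_f, ei']
  have hg : g ∘ₗ (1 - d ∘ₗ j ∘ₗ δ) = g' := by
    ext x
    simp [d, δ, D.g_f, ej]
    abel
  have E' : IsDecomp A U W f' g' ((1 - d ∘ₗ i ∘ₗ δ) ∘ₗ h) (k ∘ₗ (1 - d ∘ₗ j ∘ₗ δ)) := by
    rw [← hf, ← hg]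
    exact E
  exact E'.complement_unique D'

/-- Let `e = f'* f` and `e* e = s ^ 2`.  Then `w = e s⁻¹` is an isometry of `A`, and replacing `f'` by
`f' w`, which has the same image, replaces `e` by `w* e = s`.  As `1 - s` or `1 + s` is invertible,
the reflection between `f` and `f' w` or `-f' w` exists. -/
theorem complement_eq_of_sq (hA : A.orbitType.IsIndecomposable) (D : IsDecomp A U W f g h k)
    (D' : IsDecomp A V W f' g' h' k') {s t : Module.End ℂ A.space} (hs : IsAdjoint A A s s)
    (ht : IsAdjoint A A t t) (hst : s * t = 1) (hts : t * s = 1)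
    (hsq : ∀ x, s (s x) = g (f' (g' (f x)))) : U.orbitType = V.orbitType := by
  have h₁ : ∀ x, s (t x) = x := LinearMap.congr_fun hst
  have h₂ : ∀ x, t (s x) = x := LinearMap.congr_fun hts
  have key : ∀ w v : Module.End ℂ A.space, IsAdjoint A A w v → v * w = 1 →
      IsUnit (1 - v ∘ₗ g' ∘ₗ f) → IsUnit (1 - g ∘ₗ f' ∘ₗ w) → U.orbitType = V.orbitType := by
    intro w v hwv hvw hu hu'
    have hvw' : ∀ x, w (v x) = x := LinearMap.congr_fun (mul_eq_one_comm.1 hvw)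
    refine complement_eq_of_isUnit (f' := f' ∘ₗ w) (g' := v ∘ₗ g') (h' := h') (k' := k') D ?_ hu hu'
    exact ⟨D'.adj₁.comp hwv, D'.adj₂, fun x => by simpa [D'.g_f] using LinearMap.congr_fun hvw x,
      D'.k_h, fun x => by simpa [hvw'] using D'.add_eq x⟩
  have hw : IsAdjoint A A (g' ∘ₗ f ∘ₗ t) (t ∘ₗ g ∘ₗ f') :=
    D'.adj₁.symm.comp (D.adj₁.comp ht)
  have e₁ : t ∘ₗ g ∘ₗ f' ∘ₗ g' ∘ₗ f = s := by
    ext x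
    simp [← hsq, h₂]
  have e₂ : g ∘ₗ f' ∘ₗ g' ∘ₗ f ∘ₗ t = s := by
    ext x
    simp [← hsq, h₁]
  have e₃ : (t ∘ₗ g ∘ₗ f') * (g' ∘ₗ f ∘ₗ t) = 1 := by
    ext x
    simp [← hsq, h₁, h₂]
  rcases hs.isUnit_one_sub_or_add hA with hu | hu
  · exact key _ _ hw e₃ (by simpa only [LinearMap.comp_assoc, e₁]) (by rwa [e₂])
  · refine key _ _ hw.neg (by rw [neg_mul_neg, e₃]) ?_ ?_
    · simpa only [LinearMap.comp_assoc, LinearMap.neg_comp, e₁, sub_neg_eq_add]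
    · simpa only [LinearMap.comp_neg, e₂, sub_neg_eq_add]

end Pair.IsDecomp

/-- A decomposition `V = B + C` of the second summand of `W = A + V` gives the decomposition
`W = B + (A + C)`. -/
theorem Pair.IsDecomp.trans {A B C V W : Pair.{u} κ} {f : A.space →ₗ[ℂ] W.space}
    {g : W.space →ₗ[ℂ] A.space} {h : V.space →ₗ[ℂ] W.space} {k : W.space →ₗ[ℂ] V.space}
    {p : B.space →ₗ[ℂ] V.space} {q : V.space →ₗ[ℂ] B.space} {r : C.space →ₗ[ℂ] V.space}
    {s : V.space →ₗ[ℂ] C.space} (D : IsDecomp A V W f g h k) (E : IsDecomp B C V p q r s) :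
    IsDecomp B (A.sum C) W (h ∘ₗ p) (q ∘ₗ k)
      (f ∘ₗ fst A C + (h ∘ₗ r) ∘ₗ snd A C) (inl A C ∘ₗ g + inr A C ∘ₗ s ∘ₗ k) where
  adj₁ := D.adj₂.comp E.adj₁
  adj₂ := (D.adj₁.comp (inl_fst A C).adj₁.symm).add
    ((D.adj₂.comp E.adj₂).comp (inl_fst A C).adj₂.symm)
  g_f x := by simp [D.k_h, E.g_f]
  k_h y := by
    simp [D.g_f, D.k_h, D.k_f, D.g_h, E.k_h, (inl_fst A C).add_eq]
  add_eq w := by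
    have h₁ := D.add_eq w
    rw [← E.add_eq (k w), map_add] at h₁
    have F := inl_fst A C
    simpa [add_left_comm, F.g_f, F.k_h, F.g_h, F.k_f] using h₁

theorem OrbitType.IsIndecomposable.add_left_cancel {Δ Δ₁ Δ₂ : OrbitType.{u} κ}
    (hΔ : Δ.IsIndecomposable) (h : Δ + Δ₁ = Δ + Δ₂) : Δ₁ = Δ₂ := by
  obtain ⟨A, rfl⟩ := Δ.exists_pair
  obtain ⟨U, rfl⟩ := Δ₁.exists_pair
  obtain ⟨V, rfl⟩ := Δ₂.exists_pair
  obtain ⟨f, g, _, _, D⟩ := Pair.exists_isDecomp_of_orbitType_eq (W := A.sum V) h.symm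
  have D' := Pair.IsDecomp.inl_fst A V
  obtain ⟨s, t, hs, ht, h₁, h₂, h₃⟩ := D'.exists_sqrt hΔ D.adj₁ D.g_f
  rcases h₃ with h₃ | h₃
  · exact D.complement_eq_of_sq hΔ D' hs ht h₁ h₂ h₃
  · -- `A` embeds into `V`; compare its copies in `W` with this one
    obtain ⟨B, b, c, E⟩ := D.adj₁.exists_isDecomp_of_sq D'.adj₂ ht h₁ h₂ h₃
    have F := D'.trans E
    rw [E.mk_eq, ← Pair.orbitType_sum]
    refine D.complement_eq_of_sq hΔ F hs ht h₁ h₂ fun x => ?_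
    have e : ∀ y, t (s y) = y := LinearMap.congr_fun h₂
    simp only [LinearMap.comp_apply, ← h₃, e]

/-! ### Unique decomposition of types -/

namespace OrbitType

theorem exists_multiset_sum_eq (Δ : OrbitType.{u} κ) :
    ∃ m : Multiset (OrbitType.{u} κ), (∀ Γ ∈ m, Γ.IsIndecomposable) ∧ Δ = m.sum := by
  induction hn : Δ.dim using Nat.strong_induction_on generalizing Δ with
  | _ n ih =>
    by_cases h0 : Δ = 0
    · exact ⟨0, by simp, by simpa using h0⟩
    by_cases hI : Δ.IsIndecomposable
    · exact ⟨{Δ}, by simpa using hI, by simp⟩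
    obtain ⟨Δ₁, Δ₂, h, h₁, h₂⟩ : ∃ Δ₁ Δ₂ : OrbitType.{u} κ, Δ = Δ₁ + Δ₂ ∧ Δ₁ ≠ 0 ∧ Δ₂ ≠ 0 := by
      by_contra! hc
      exact hI ⟨h0, fun Δ₁ Δ₂ h => or_iff_not_imp_left.2 (hc Δ₁ Δ₂ h)⟩
    have hd := dim_add Δ₁ Δ₂
    have := dim_pos h₁
    have := dim_pos h₂
    rw [← h] at hd
    obtain ⟨m₁, hm₁, e₁⟩ := ih Δ₁.dim (by omega) Δ₁ rfl
    obtain ⟨m₂, hm₂, e₂⟩ := ih Δ₂.dim (by omega) Δ₂ rfl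
    refine ⟨m₁ + m₂, fun Γ hΓ => ?_, by rw [Multiset.sum_add, ← e₁, ← e₂, h]⟩
    exact (Multiset.mem_add.1 hΓ).elim (hm₁ Γ) (hm₂ Γ)

protected theorem add_left_cancel {Δ Δ₁ Δ₂ : OrbitType.{u} κ} (h : Δ + Δ₁ = Δ + Δ₂) :
    Δ₁ = Δ₂ := by
  obtain ⟨m, hm, rfl⟩ := Δ.exists_multiset_sum_eq
  induction m using Multiset.induction_on with
  | empty => simpa using h
  | cons a m ih =>
    rw [Multiset.forall_mem_cons] at hm
    rw [Multiset.sum_cons, add_assoc, add_assoc] at h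
    exact ih hm.2 (hm.1.add_left_cancel h)

theorem eq_zero_of_add_eq_zero {Δ Γ : OrbitType.{u} κ} (h : Δ + Γ = 0) : Δ = 0 := by
  by_contra h0
  have := dim_pos h0
  have h₁ := dim_add Δ Γ
  have h₂ := dim_add (0 : OrbitType.{u} κ) 0
  rw [h] at h₁
  rw [add_zero] at h₂
  omega

theorem IsIndecomposable.mem_of_sum_eq {Δ Γ : OrbitType.{u} κ} (hΔ : Δ.IsIndecomposable)
    {m : Multiset (OrbitType.{u} κ)} (hm : ∀ Γ ∈ m, Γ.IsIndecomposable) (h : m.sum = Δ + Γ) :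
    Δ ∈ m := by
  induction m using Multiset.induction_on generalizing Γ with
  | empty => exact absurd (eq_zero_of_add_eq_zero h.symm) hΔ.1
  | cons a m ih =>
    rw [Multiset.forall_mem_cons] at hm
    rw [Multiset.sum_cons] at h
    rw [Multiset.mem_cons]
    rcases hΔ.exists_eq_add h with ⟨Γ₁, h₁⟩ | ⟨Γ₂, h₂⟩
    · left
      rcases hm.1.2 _ _ h₁ with h₀ | h₀
      · exact absurd h₀ hΔ.1
      · rw [h₁, h₀, add_zero]
    · exact .inr (ih hm.2 h₂)

theorem multiset_eq_of_sum_eq {m m' : Multiset (OrbitType.{u} κ)}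
    (hm : ∀ Γ ∈ m, Γ.IsIndecomposable) (hm' : ∀ Γ ∈ m', Γ.IsIndecomposable)
    (h : m.sum = m'.sum) : m = m' := by
  induction m using Multiset.induction_on generalizing m' with
  | empty =>
    refine (Multiset.eq_zero_of_forall_notMem fun a ha => (hm' a ha).1 ?_).symm
    obtain ⟨m'', rfl⟩ := Multiset.exists_cons_of_mem ha
    rw [Multiset.sum_zero, Multiset.sum_cons] at h
    exact eq_zero_of_add_eq_zero h.symm
  | cons a m ih =>
    rw [Multiset.forall_mem_cons] at hm
    rw [Multiset.sum_cons] at h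
    obtain ⟨m'', rfl⟩ := Multiset.exists_cons_of_mem (hm.1.mem_of_sum_eq hm' h.symm)
    rw [Multiset.forall_mem_cons] at hm'
    rw [Multiset.sum_cons] at h
    rw [ih hm.2 hm'.2 (OrbitType.add_left_cancel h)]

end OrbitType

/-! ### Decompositions of distinguished types -/

theorem DistType.exists_triple (D : DistType.{u} κ) : ∃ A : Triple.{u} κ, A.distType = D :=
  Quotient.exists_rep D

namespace DistType

/-- The type obtained by forgetting the distinguished vector. -/
def orbitType : DistType.{u} κ → OrbitType.{u} κ :=
  Quotient.lift (fun A => A.toPair.orbitType) fun _ _ ⟨P, h, _⟩ => Quotient.sound ⟨P, h⟩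

theorem orbitType_add (D : DistType.{u} κ) (Δ : OrbitType.{u} κ) :
    (D + Δ).orbitType = D.orbitType + Δ := by
  obtain ⟨A, rfl⟩ := D.exists_triple
  obtain ⟨B, rfl⟩ := Δ.exists_pair
  rfl

protected theorem add_zero (D : DistType.{u} κ) : D + (0 : OrbitType.{u} κ) = D := by
  obtain ⟨A, rfl⟩ := D.exists_triple
  obtain ⟨P, hP, hv⟩ : ∃ P, Pair.IsEquiv (A.toPair.sum (Pair.zero κ)) A.toPair P ∧
      P (Pair.inl _ _ A.v₀) = A.v₀ :=
    ⟨LinearEquiv.prodUnique (R := ℂ) (M := A.space) (M₂ := PUnit.{u + 1}),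
      ⟨⟨fun _ => rfl, fun _ _ => (add_zero _).symm, fun _ _ => (add_zero _).symm⟩, fun _ => rfl⟩,
      rfl⟩
  exact Quotient.sound ⟨P, hP, hv⟩

protected theorem add_assoc (D : DistType.{u} κ) (Δ Γ : OrbitType.{u} κ) :
    D + Δ + Γ = D + (Δ + Γ) := by
  obtain ⟨A, rfl⟩ := D.exists_triple
  obtain ⟨B, rfl⟩ := Δ.exists_pair
  obtain ⟨C, rfl⟩ := Γ.exists_pair
  exact Quotient.sound ⟨LinearEquiv.prodAssoc ℂ A.space B.space C.space,
    ⟨⟨fun _ => rfl, fun _ _ => (add_assoc _ _ _).symm, fun _ _ => (add_assoc _ _ _).symm⟩,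
      fun _ => rfl⟩, rfl⟩

end DistType

namespace Triple

variable {T : Triple.{u} κ} {A B : Pair.{u} κ} {f : A.space →ₗ[ℂ] T.space}
  {g : T.space →ₗ[ℂ] A.space} {h : B.space →ₗ[ℂ] T.space} {k : T.space →ₗ[ℂ] B.space}

/-- The first summand of a decomposition of a triple, if it contains the distinguished vector. -/
def ofDecomp (D : Pair.IsDecomp A B T.toPair f g h k)
    (hv : f (g T.v₀) = T.v₀) : Triple.{u} κ where
  toPair := A
  v₀ := g T.v₀
  special := by
    obtain ⟨h₁, h₂, h₃, h₄⟩ := T.special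
    refine ⟨fun h₀ => h₁ (by rw [← hv, h₀, map_zero]), fun hs => ?_, ?_, ?_⟩
    · rw [← D.adj₁.map_σ', ← map_neg]
      exact (h₂ hs).imp (congrArg g) (congrArg g)
    · rw [← D.adj₁.τ_left, hv, h₃]
    · rw [← D.adj₁.τs_left, hv, h₄]
  Y_v₀ := by rw [← D.adj₁.map_Y', T.Y_v₀, map_zero]

theorem distType_eq_add (D : Pair.IsDecomp A B T.toPair f g h k) (hv : f (g T.v₀) = T.v₀) :
    T.distType = (ofDecomp D hv).distType + B.orbitType := by
  have h₁ : h (k T.v₀) = 0 := by simpa [hv] using D.add_eq T.v₀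
  have h₂ : k T.v₀ = 0 := by rw [← D.k_h (k T.v₀), h₁, map_zero]
  exact Quotient.sound ⟨D.equiv, D.isEquiv, Prod.ext rfl h₂⟩

theorem eq_one_of_isIndecomposable (hT : T.distType.IsIndecomposable) {e : Module.End ℂ T.space}
    (he : Pair.IsAdjoint T.toPair T.toPair e e) (hi : e * e = e) (hv : e T.v₀ = T.v₀) : e = 1 := by
  obtain ⟨B, h, k, D⟩ := he.isDecomp_part (LinearMap.congr_fun hi)
  have h0 := hT _ _ (distType_eq_add D hv)
  rw [Pair.orbitType_eq_zero_iff] at h0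
  ext x
  have := D.add_eq x
  rw [h0 (k x), map_zero, add_zero] at this
  exact this

/-- In an indecomposable triple, a self-adjoint endomorphism with eigenvector `v⁰` has no other
eigenvalue: the generalized eigenspace which contains `v⁰` is an orthogonal summand. -/
theorem isNilpotent_of_isIndecomposable (hT : T.distType.IsIndecomposable)
    {a : Module.End ℂ T.space} (ha : Pair.IsAdjoint T.toPair T.toPair a a) {c : ℝ}
    (hv : a T.v₀ = c • T.v₀) :
    IsNilpotent (Polynomial.aeval a (Polynomial.X - Polynomial.C c)) := by
  obtain ⟨p, n, hp, ⟨r, hr⟩, h0⟩ := exists_idempotent_aeval (Pair.isIntegral_end a)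
    (Polynomial.irreducible_X_sub_C c)
  have hpc : p.eval c = 1 := by
    have := congrArg (Polynomial.eval c) hr
    simpa [sub_eq_zero] using this
  have h₁ := eq_one_of_isIndecomposable hT (ha.aeval p) hp
    (by rw [aeval_apply_of_eigenvector hv, hpc, one_smul])
  exact ⟨n, by rwa [h₁, mul_one] at h0⟩

/-- `Y ^ 2` is self-adjoint and kills `v⁰`. -/
theorem isNilpotent_Y (hT : T.distType.IsIndecomposable) : IsNilpotent T.Y := by
  have ha : Pair.IsAdjoint T.toPair T.toPair (T.Y * T.Y) (T.Y * T.Y) := by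
    simpa using (Pair.IsAdjoint.Y_neg_Y T.toPair).mul (Pair.IsAdjoint.Y_neg_Y T.toPair)
  obtain ⟨n, hn⟩ := isNilpotent_of_isIndecomposable hT ha (c := 0) (by simp [T.Y_v₀])
  refine ⟨2 * n, ?_⟩
  rw [pow_mul, sq]
  simpa using hn

/-- Let `e` be the orthogonal projection to the second summand, restricted to the first one.  Both
`e* e` and `e e*` fix the distinguished vectors, so they are unipotent, and `e (e* e)^(-1/2)` is
an equivalence. -/
theorem distType_eq_of_isIndecomposable {T₁ T₂ : Triple.{u} κ}
    (h₁ : T₁.distType.IsIndecomposable) (h₂ : T₂.distType.IsIndecomposable)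
    {Δ₁ Δ₂ : OrbitType.{u} κ} (h : T₁.distType + Δ₁ = T₂.distType + Δ₂) :
    T₁.distType = T₂.distType := by
  obtain ⟨B₁, rfl⟩ := Δ₁.exists_pair
  obtain ⟨B₂, rfl⟩ := Δ₂.exists_pair
  obtain ⟨P, hP, hPv⟩ : ∃ P, Pair.IsEquiv (T₁.toPair.sum B₁) (T₂.toPair.sum B₂) P ∧
    P (Pair.inl _ _ T₁.v₀) = Pair.inl _ _ T₂.v₀ := Quotient.exact h
  have D₁ := (Pair.IsDecomp.inl_fst T₁.toPair B₁).map hP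
  have D₂ := Pair.IsDecomp.inl_fst T₂.toPair B₂
  obtain ⟨e, e', he, hev, hev'⟩ : ∃ e e', Pair.IsAdjoint T₁.toPair T₂.toPair e e' ∧
      e T₁.v₀ = T₂.v₀ ∧ e' T₂.v₀ = T₁.v₀ := by
    refine ⟨_, _, D₂.adj₁.symm.comp D₁.adj₁, ?_, ?_⟩
    · simp [hPv, D₂.g_f]
    · simp [← hPv, (Pair.IsDecomp.inl_fst T₁.toPair B₁).g_f]
  have hone : minpoly ℝ (1 : ℂ) = Polynomial.X - Polynomial.C 1 := by
    rw [minpoly.one, Polynomial.C_1]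
  have unip : ∀ {T : Triple.{u} κ} (_ : T.distType.IsIndecomposable) {a : Module.End ℂ T.space}
      (_ : Pair.IsAdjoint T.toPair T.toPair a a) (_ : a T.v₀ = T.v₀),
      IsNilpotent (Polynomial.aeval a (minpoly ℝ (1 : ℂ))) ∧ IsUnit a := by
    intro T hT a ha hv
    have := isNilpotent_of_isIndecomposable hT ha (c := 1) (by rw [hv, one_smul])
    rw [← hone] at this
    refine ⟨this, ?_⟩
    simpa using isUnit_aeval_of_isNilpotent_minpoly this (g := Polynomial.X) (by simp)
  obtain ⟨hn, hu⟩ := unip h₁ (he.symm.comp he) (by simp [hev, hev'])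
  obtain ⟨-, hu'⟩ := unip h₂ (he.comp he.symm) (by simp [hev, hev'])
  obtain ⟨p, hp⟩ := exists_aeval_mul_self_eq hn (g := Polynomial.X) (by simp)
  have hpv := aeval_apply_of_eigenvector (a := e' ∘ₗ e) (v := T₁.v₀) (c := 1)
    (by simp [hev, hev']) p
  have hs := (he.symm.comp he).aeval p
  rw [Polynomial.aeval_X] at hp
  -- the square root `s` of `e* e` multiplies `v⁰` by a sign `r`, so that `r • s` fixes `v⁰`
  generalize Polynomial.aeval (e' ∘ₗ e) p = s at hp hpv hs
  generalize p.eval 1 = r at hpv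
  have hr : r * r = 1 := by
    have h₃ := LinearMap.congr_fun hp T₁.v₀
    rw [Module.End.mul_apply, hpv, LinearMap.map_smul_of_tower, hpv, smul_smul,
      LinearMap.comp_apply, hev, hev'] at h₃
    exact smul_left_injective ℝ T₁.special.1 (h₃.trans (one_smul ℝ _).symm)
  rw [← hp] at hu
  obtain ⟨t, hst, hts⟩ := isUnit_iff_exists.1 ((Commute.refl s).isUnit_mul_iff.1 hu).1
  have hst' : ∀ x, s (t x) = x := LinearMap.congr_fun hst
  have hts' : ∀ x, t (s x) = x := LinearMap.congr_fun hts
  have hee : ∀ x, e' (e x) = s (s x) := fun x => (LinearMap.congr_fun hp x).symm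
  have ht := hs.inverse hts' hst' hts' hst'
  have hw := he.comp (ht.smul r)
  have htv : t T₁.v₀ = r • T₁.v₀ := by
    rw [← hts' (r • T₁.v₀), LinearMap.map_smul_of_tower, hpv, smul_smul, hr, one_smul]
  have hl : ((r • t) ∘ₗ e') ∘ₗ (e ∘ₗ (r • t)) = LinearMap.id := by
    ext x
    simp [hee, LinearMap.map_smul_of_tower, smul_smul, hr, hst', hts']
  have hr' : (e ∘ₗ (r • t)) ∘ₗ ((r • t) ∘ₗ e') = LinearMap.id := by
    ext y
    obtain ⟨b, hb, -⟩ := isUnit_iff_exists.1 hu'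
    have hy : e (e' (b y)) = y := LinearMap.congr_fun hb y
    rw [← hy]
    simp [hee, LinearMap.map_smul_of_tower, smul_smul, hr, hts']
  refine Quotient.sound ⟨LinearEquiv.ofLinearMap _ _ hr' hl, Pair.IsAdjoint.isEquiv hw, ?_⟩
  simp [htv, smul_smul, hr, hev]

end Triple

namespace DistType

theorem IsIndecomposable.isNilpotent {D : DistType.{u} κ} (hD : D.IsIndecomposable) :
    D.IsNilpotent := by
  obtain ⟨T, rfl⟩ := D.exists_triple
  exact ⟨T, rfl, T.isNilpotent_Y hD⟩

theorem exists_isIndecomposable_add (D : DistType.{u} κ) :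
    ∃ (D' : DistType.{u} κ) (Δ : OrbitType.{u} κ), D'.IsIndecomposable ∧ D = D' + Δ := by
  induction hn : D.orbitType.dim using Nat.strong_induction_on generalizing D with
  | _ n ih =>
    by_cases hD : D.IsIndecomposable
    · exact ⟨D, 0, hD, D.add_zero.symm⟩
    · simp only [IsIndecomposable, not_forall] at hD
      obtain ⟨D₁, Δ, h, hΔ⟩ := hD
      have h₁ := OrbitType.dim_pos hΔ
      have h₂ := OrbitType.dim_add D₁.orbitType Δ
      rw [← orbitType_add, ← h] at h₂
      obtain ⟨D', Δ', hD', h'⟩ := ih _ (by omega) D₁ rfl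
      exact ⟨D', Δ' + Δ, hD', by rw [h, h', DistType.add_assoc]⟩

theorem existsUnique_decomposition (D : DistType.{u} κ) :
    ∃! p : DistType.{u} κ × Multiset (OrbitType.{u} κ),
      p.1.IsIndecomposable ∧ p.1.IsNilpotent ∧ (∀ Δ ∈ p.2, Δ.IsIndecomposable) ∧
        D = p.1 + p.2.sum := by
  obtain ⟨D', Δ, hD', h⟩ := D.exists_isIndecomposable_add
  obtain ⟨m, hm, rfl⟩ := Δ.exists_multiset_sum_eq
  refine ⟨(D', m), ⟨hD', hD'.isNilpotent, hm, h⟩, ?_⟩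
  rintro ⟨D₁, m₁⟩ ⟨hD₁, -, hm₁, h₁⟩
  have e : D₁ = D' := by
    obtain ⟨T₁, rfl⟩ := D₁.exists_triple
    obtain ⟨T', rfl⟩ := D'.exists_triple
    exact Triple.distType_eq_of_isIndecomposable hD₁ hD' (h₁.symm.trans h)
  subst e
  have h₂ := congrArg orbitType (h₁.symm.trans h)
  rw [orbitType_add, orbitType_add] at h₂
  exact congrArg _ (OrbitType.multiset_eq_of_sum_eq hm₁ hm (OrbitType.add_left_cancel h₂))

end DistType

/-! ### Orbits of the isotropy group -/

namespace Space

theorem triple_distType_eq_iff (S : Space.{u} κ) {v₀ : S} (hv : S.IsSpecial v₀)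
    (X Y : S.isotropyLieAlgebra v₀) :
    (S.triple hv X).distType = (S.triple hv Y).distType ↔ ∃ P : S.isotropyGroup v₀, P • X = Y := by
  constructor
  · intro h
    obtain ⟨P, ⟨hP, hXY⟩, hPv⟩ : ∃ P : S ≃ₗ[ℂ] S,
      Pair.IsEquiv (S.triple hv X).toPair (S.triple hv Y).toPair P ∧ P v₀ = v₀ := Quotient.exact h
    refine ⟨⟨P, hP, hPv⟩, Subtype.ext (LinearMap.ext fun w => ?_)⟩
    exact (hXY (P.symm w)).trans (congrArg Y.1 (P.apply_symm_apply w))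
  · rintro ⟨P, rfl⟩
    exact Quotient.sound ⟨P.1, ⟨P.2.1, fun w => (congrArg (fun x => P.1 (X.1 x))
      (P.1.symm_apply_apply w)).symm⟩, P.2.2⟩

theorem exists_orbit_equiv (S : Space.{u} κ) (v₀ : S) (hv : S.IsSpecial v₀) :
    ∃ e : MulAction.orbitRel.Quotient (S.isotropyGroup v₀) (S.isotropyLieAlgebra v₀) ≃
        S.distTypes v₀,
      ∀ Y : S.isotropyLieAlgebra v₀,
        (e (Quotient.mk _ Y) : DistType.{u} κ) = Quotient.mk _ (S.triple hv Y) := by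
  let F : MulAction.orbitRel.Quotient (S.isotropyGroup v₀) (S.isotropyLieAlgebra v₀) →
      S.distTypes v₀ :=
    Quotient.lift
      (fun Y => ⟨(S.triple hv Y).distType, S.triple hv Y, rfl, LinearEquiv.refl ℂ S, .refl S, rfl⟩)
      fun X Y hXY => Subtype.ext (((S.triple_distType_eq_iff hv Y X).2 hXY).symm)
  refine ⟨Equiv.ofBijective F ⟨?_, ?_⟩, fun Y => rfl⟩
  · rintro ⟨X⟩ ⟨Y⟩ h
    exact Quotient.sound ((S.triple_distType_eq_iff hv Y X).1 (congrArg Subtype.val h).symm)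
  · rintro ⟨_, A, rfl, P, hP, hPv⟩
    have hQ := hP.symm.1
    have hY : P.conj A.Y ∈ S.isotropyLieAlgebra v₀ := by
      obtain ⟨a₁, a₂, a₃⟩ := A.mem
      refine ⟨⟨fun v => ?_, fun u v => ?_, fun u v => ?_⟩, ?_⟩
      · simp [LinearEquiv.conj_apply, hQ, a₁, hP.1]
      · have := a₂ (P.symm u) (P.symm v)
        rw [← hP.2.1, ← hP.2.1] at this
        simpa [LinearEquiv.conj_apply] using this
      · have := a₃ (P.symm u) (P.symm v)
        rw [← hP.2.2, ← hP.2.2] at this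
        simpa [LinearEquiv.conj_apply] using this
      · simp [LinearEquiv.conj_apply, ← hPv, A.Y_v₀]
    refine ⟨Quotient.mk _ ⟨P.conj A.Y, hY⟩, Subtype.ext (Eq.symm ?_)⟩
    exact Quotient.sound ⟨P, ⟨hP, fun w => (congrArg (fun x => P (A.Y x))
      (P.symm_apply_apply w)).symm⟩, hPv⟩

end Space

end AffineOrbits

theorem theorem2p1 (κ : AffineOrbits.Kind) :
    -- every distinguished type has a decomposition, unique up to reordering of the summands
    (∀ D : AffineOrbits.DistType.{u} κ,
      ∃! p : AffineOrbits.DistType.{u} κ × Multiset (AffineOrbits.OrbitType.{u} κ),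
        p.1.IsIndecomposable ∧ p.1.IsNilpotent ∧ (∀ Δ ∈ p.2, Δ.IsIndecomposable) ∧
          D = p.1 + p.2.sum) ∧
    -- distinguished types on a given space correspond to adjoint orbits of the isotropy group
    (∀ (S : AffineOrbits.Space.{u} κ) (v₀ : S) (hv : S.IsSpecial v₀),
      ∃ e : MulAction.orbitRel.Quotient (S.isotropyGroup v₀) (S.isotropyLieAlgebra v₀) ≃
          S.distTypes v₀,
        ∀ Y : S.isotropyLieAlgebra v₀,
          (e (Quotient.mk _ Y) : AffineOrbits.DistType.{u} κ) =
            Quotient.mk _ (S.triple hv Y)) :=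
  ⟨AffineOrbits.DistType.existsUnique_decomposition, AffineOrbits.Space.exists_orbit_equiv⟩
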